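/- For $n\ge 1$, an $\alpha/\beta$-staircase tableau of size $n$ is a filling of the Young diagram of shape $(n,n-1,\dots,1)$ (box $(i,j)$ in row $i$ and column $j$, numbered from the north-west corner, $i,j\ge 1$, $i+j\le n+1$) in which every box is empty or contains a symbol $\alpha$ or $\beta$, such that: every box with $i+j=n+1$ contains a symbol; all boxes in the same column as and north of an $\alpha$ are empty; all boxes in the same row as and west of a $\beta$ are empty. Let $\mathcal S_n$ be the set of these tableaux. For real numbers $\alpha,\beta>0$ let $wt(S)=\alpha^{\#\alpha(S)}\beta^{\#\beta(S)}$ be the product of the symbols in $S$, let $Z_n(\alpha,\beta)=\sum_{S\in\mathcal S_n}wt(S)$, and let $\mathbb P_{n,\alpha,\beta}(S)=wt(S)/Z_n(\alpha,\beta)$. The values $\alpha=\infty$ with fixed $\beta\in(0,\infty)$, $\beta=\infty$ with fixed $\alpha\in(0,\infty)$, and $\alpha=\beta=\infty$ are also allowed: then $\mathbb P_{n,\alpha,\beta}$ denotes the (existing) limit of these probabilities as $\alpha\to\infty$, as $\beta\to\infty$, or as $\alpha=\beta\to\infty$, respectively. The $k$-th diagonal is the set of boxes $(i,j)$ with $i+j=n-k+2$.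 Theorem 5.1. Fix an integer $k>1$ and parameters $\alpha,\beta$ as above. Let $A_n$ and $B_n$ be the numbers of $\alpha$'s and of $\beta$'s on the $k$-th diagonal of a random tableau $S\in\mathcal S_n$ with law $\mathbb P_{n,\alpha,\beta}$. Then, as $n\to\infty$, $$(A_n,B_n)\xrightarrow{d}(Z_1,Z_2),$$ where $Z_1$ and $Z_2$ are independent Poisson random variables with parameter $1/2$. Hence the total number $A_n+B_n$ of symbols on the $k$-th diagonal converges in distribution to a Poisson random variable with parameter $1$. -/

import Mathlib

open Filter Topology MeasureTheory ProbabilityTheory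

/-- The two symbols of an `α/β`-staircase tableau. -/
inductive StSymbol where
  | alpha
  | beta
  deriving DecidableEq

/-- The filling rules of an `α/β`-staircase tableau of size `n`. Rows and columns are numbered from
the north-west corner starting at `0`, so the boxes of the shape `(n, n - 1, …, 1)` are the pairs
`(i, j)` with `i + j < n`, and the first diagonal consists of those with `i + j + 1 = n`.
`T i j = none` means that there is no symbol at `(i, j)`. -/
structure IsStaircaseFilling (n : ℕ) (T : Fin n → Fin n → Option StSymbol) : Prop where
  /-- Symbols are placed only in boxes of the shape. -/
  outside : ∀ i j : Fin n, n ≤ (i : ℕ) + (j : ℕ) → T i j = none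
  /-- Each box of the first diagonal contains a symbol. -/
  diagonal : ∀ i j : Fin n, (i : ℕ) + (j : ℕ) + 1 = n → T i j ≠ none
  /-- All boxes in the same column and north of an `α` are empty. -/
  north_alpha : ∀ i j : Fin n, T i j = some .alpha → ∀ i' : Fin n, i' < i → T i' j = none
  /-- All boxes in the same row and west of a `β` are empty. -/
  west_beta : ∀ i j : Fin n, T i j = some .beta → ∀ j' : Fin n, j' < j → T i j' = none

/-- The set `𝒮ₙ` of `α/β`-staircase tableaux of size `n`. -/
def StaircaseTableau (n : ℕ) : Type :=
  {T : Fin n → Fin n → Option StSymbol // IsStaircaseFilling n T}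

instance : Finite StSymbol :=
  Finite.of_injective (fun s : StSymbol => decide (s = .alpha)) (by
    intro s t h
    cases s <;> cases t <;> simp_all)

instance (n : ℕ) : Finite (StaircaseTableau n) :=
  inferInstanceAs (Finite {T : Fin n → Fin n → Option StSymbol // IsStaircaseFilling n T})

noncomputable instance (n : ℕ) : Fintype (StaircaseTableau n) := Fintype.ofFinite _

/-- Every set of tableaux is an event. -/
instance (n : ℕ) : MeasurableSpace (StaircaseTableau n) := ⊤

instance (n : ℕ) : DiscreteMeasurableSpace (StaircaseTableau n) := ⟨fun _ => trivial⟩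

namespace StaircaseTableau

/-- The number of occurrences of the symbol `x` in the tableau `S`. -/
def count {n : ℕ} (x : StSymbol) (S : StaircaseTableau n) : ℕ :=
  (Finset.univ.filter fun p : Fin n × Fin n => S.1 p.1 p.2 = some x).card

/-- The number of occurrences of `x` on the `k`-th diagonal of `S`. In one-based coordinates this
diagonal is `i + j = n - k + 2`; in the zero-based coordinates used here it is `i + j + k = n`. -/
def diagCount {n : ℕ} (k : ℕ) (x : StSymbol) (S : StaircaseTableau n) : ℕ :=
  (Finset.univ.filter fun p : Fin n × Fin n =>
    (p.1 : ℕ) + (p.2 : ℕ) + k = n ∧ S.1 p.1 p.2 = some x).card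

/-- The weight of `S`: the product of all its symbols. -/
def weight {n : ℕ} (α β : ℝ) (S : StaircaseTableau n) : ℝ :=
  α ^ S.count .alpha * β ^ S.count .beta

/-- The weight generating function `Zₙ(α, β)`. -/
noncomputable def partitionFunction (n : ℕ) (α β : ℝ) : ℝ :=
  ∑ S : StaircaseTableau n, S.weight α β

/-- The probability `wt(S) / Zₙ(α, β)` of the tableau `S`. -/
noncomputable def prob {n : ℕ} (α β : ℝ) (S : StaircaseTableau n) : ℝ :=
  S.weight α β / partitionFunction n α β

end StaircaseTableau

/-- The admissible ways of choosing the parameters `(α, β)`, each given as a filter along which the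
probabilities of tableaux are to be taken: fixed positive reals, `α → ∞` with `β` fixed,
`β → ∞` with `α` fixed, or `α = β → ∞`. -/
inductive IsParameterRegime : Filter (ℝ × ℝ) → Prop where
  | fixed (α β : ℝ) (hα : 0 < α) (hβ : 0 < β) : IsParameterRegime (pure (α, β))
  | alphaInfinite (β : ℝ) (hβ : 0 < β) : IsParameterRegime (map (fun t : ℝ => (t, β)) atTop)
  | betaInfinite (α : ℝ) (hα : 0 < α) : IsParameterRegime (map (fun t : ℝ => (α, t)) atTop)
  | bothInfinite : IsParameterRegime (map (fun t : ℝ => (t, t)) atTop)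

/-! Put `a = 1 / α` and `b = 1 / β`. A row has at most one β and a column at most one α, so up to
the factor `α ^ n * β ^ n` a tableau weighs `a` to the number of columns without α times `b` to the
number of rows without β (free rows). Infinite parameters become `a → 0` or `b → 0`.

A tableau of size `n + 1` is a tableau `S` of size `n` with a column attached on the left, whose
symbols lie in the new bottom row or in free rows of `S`. The columns over `S` have total weight `(a
+ b) * (b + 1) ^ S.freeCount`, so deleting the first column of a random tableau leaves a random
tableau with parameters `(a, b + 1)` (`avg_succ`). A tableau of size `n` therefore grows as a Markov
chain whose stage of size `t` has second parameter `b + n - t`.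

Each new column, once long enough, adds one box to the `k`-th diagonal. With `j` columns still to
come, the row of this box is free with probability about `j / n`, and a box in a free row is filled
with probability about `1 / j`. So the box is filled with probability about `1 / n` and holds α with
probability about `j / n ^ 2`; these sum to `1` and `1 / 2`, whence rate `1 / 2` for each symbol.

These probabilities hardly depend on the earlier part of the diagonal. The row is created only `k -
1` columns before its diagonal box, the intervening columns mark the diagonal with probability `O(1
/ j)` each, and the remaining dependence is through `r ^ freeCount`, which concentrates because the
number of free rows is distributed as a sum of independent Bernoulli variables. Hence a column
multiplies the generating function of the diagonal by `exp (increment x y n j)` up to `O(√n / j ^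
2)` (`norm_markAvg_one_succ_sub_exp_le`). Columns with `j ≥ δ n` contribute a vanishing total error;
the others contribute `O(δ)` by the crude bound `O(1 / n)` per column.

The resulting limit `exp ((x - 1) / 2 + (y - 1) / 2)` is uniform in `0 < a, b ≤ M`
(`eventually_norm_markAvg_sub_le`), so it survives the passage to infinite parameters. On the unit
circles it is the characteristic function of two independent Poisson variables, and Lévy's
continuity theorem concludes. -/

instance : Fintype StSymbol := ⟨{.alpha, .beta}, by rintro (_ | _) <;> simp⟩

/-! ### Columns that can be added to the left of a tableau -/

/-- `c` is a legal first column of a tableau whose rows admitting a symbol in that column are the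
rows satisfying `G`. -/
structure IsColumn {n : ℕ} (G : Fin (n + 1) → Prop) (c : Fin (n + 1) → Option StSymbol) :
    Prop where
  bottom : c (Fin.last n) ≠ none
  avail : ∀ i, c i ≠ none → G i
  north : ∀ i, c i = some .alpha → ∀ i' < i, c i' = none

/-- The number of rows strictly above the bottom one that satisfy `G`. -/
noncomputable def availCount {n : ℕ} (G : Fin (n + 1) → Prop) : ℕ := by
  classical exact (Finset.univ.filter fun i : Fin n => G i.castSucc).card

/-- The weight `b` to the number of rows that remain free after the column `c` is added. -/
noncomputable def rowWeight {n : ℕ} (b : ℝ) (G : Fin (n + 1) → Prop)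
    (c : Fin (n + 1) → Option StSymbol) : ℝ := by
  classical exact ∏ i, if G i ∧ c i ≠ some .beta then b else 1

/-- Sum over the legal columns without the symbol `α`. -/
noncomputable def sumNoAlpha {n : ℕ} (b : ℝ) (G : Fin (n + 1) → Prop)
    (g : (Fin (n + 1) → Option StSymbol) → ℝ) : ℝ := by
  classical exact ∑ c, if IsColumn G c ∧ ∀ i, c i ≠ some .alpha then rowWeight b G c * g c else 0

/-- Sum over the legal columns with a symbol `α`. -/
noncomputable def sumAlpha {n : ℕ} (b : ℝ) (G : Fin (n + 1) → Prop)
    (g : (Fin (n + 1) → Option StSymbol) → ℝ) : ℝ := by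
  classical exact ∑ c, if IsColumn G c ∧ ∃ i, c i = some .alpha then rowWeight b G c * g c else 0

section Column

variable {n : ℕ} {b : ℝ}

lemma sum_column_succ (g : (Fin (n + 2) → Option StSymbol) → ℝ) :
    ∑ c, g c = ∑ c : Fin (n + 1) → Option StSymbol,
      (g (Fin.cons none c) + g (Fin.cons (some .alpha) c) + g (Fin.cons (some .beta) c)) := by
  rw [← (Fin.consEquiv fun _ : Fin (n + 2) => Option StSymbol).sum_comp, Fintype.sum_prod_type_right]
  refine Finset.sum_congr rfl fun c _ => ?_
  rw [Fintype.sum_option]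
  have : (Finset.univ : Finset StSymbol) = {.alpha, .beta} := rfl
  rw [this, Finset.sum_pair (by simp)]
  simp [Fin.consEquiv, add_assoc]

lemma isColumn_cons_none (G : Fin (n + 2) → Prop) (c : Fin (n + 1) → Option StSymbol) :
    IsColumn G (Fin.cons none c) ↔ IsColumn (fun i => G i.succ) c := by
  constructor
  · rintro ⟨h1, h2, h3⟩
    refine ⟨by simpa [← Fin.succ_last] using h1, fun i hi => h2 i.succ (by simpa using hi),
      fun i hi i' hi' => ?_⟩
    simpa using h3 i.succ (by simpa using hi) i'.succ (by simpa using hi')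
  · rintro ⟨h1, h2, h3⟩
    refine ⟨by simpa [← Fin.succ_last] using h1, fun i => ?_, fun i => ?_⟩
    · cases i using Fin.cases <;> simp_all
    · cases i using Fin.cases with
      | zero => simp
      | succ i =>
        intro hi i' hi'
        cases i' using Fin.cases with
        | zero => simp
        | succ i' => simpa using h3 i (by simpa using hi) i' (by simpa using hi')

/-- A symbol in the top box, of either kind, is north of every other box, so no α may lie below it.
-/
lemma isColumn_cons_some (G : Fin (n + 2) → Prop) (c : Fin (n + 1) → Option StSymbol)
    (x : StSymbol) :
    IsColumn G (Fin.cons (some x) c) ↔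
      G 0 ∧ IsColumn (fun i => G i.succ) c ∧ ∀ i, c i ≠ some .alpha := by
  constructor
  · rintro ⟨h1, h2, h3⟩
    refine ⟨h2 0 (by simp), ⟨by simpa [← Fin.succ_last] using h1,
      fun i hi => h2 i.succ (by simpa using hi), fun i hi i' hi' => ?_⟩, fun i hi => ?_⟩
    · simpa using h3 i.succ (by simpa using hi) i'.succ (by simpa using hi')
    · simpa using h3 i.succ (by simpa using hi) 0 (by simp)
  · rintro ⟨h0, ⟨h1, h2, h3⟩, h4⟩
    refine ⟨by simpa [← Fin.succ_last] using h1, fun i => ?_, fun i => ?_⟩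
    · cases i using Fin.cases <;> simp_all
    · cases i using Fin.cases with
      | zero => intro _ i' hi'; simp at hi'
      | succ i => intro hi; exact absurd (by simpa using hi) (h4 i)

open Classical in
lemma rowWeight_cons (G : Fin (n + 2) → Prop) (c : Fin (n + 1) → Option StSymbol)
    (o : Option StSymbol) :
    rowWeight b G (Fin.cons o c) = (if G 0 ∧ o ≠ some .beta then b else 1) *
      rowWeight b (fun i => G i.succ) c := by
  simp [rowWeight, Fin.prod_univ_succ]

open Classical in
lemma sumNoAlpha_succ (G : Fin (n + 2) → Prop) (g : (Fin (n + 2) → Option StSymbol) → ℝ) :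
    sumNoAlpha b G g =
      (if G 0 then b else 1) * sumNoAlpha b (fun i => G i.succ) (fun c => g (Fin.cons none c)) +
      (if G 0 then sumNoAlpha b (fun i => G i.succ) (fun c => g (Fin.cons (some .beta) c))
        else 0) := by
  simp only [sumNoAlpha, sum_column_succ, isColumn_cons_none, isColumn_cons_some, rowWeight_cons,
    Fin.forall_fin_succ, Fin.cons_zero, Fin.cons_succ]
  by_cases h0 : G 0
  · simp only [h0, if_true, Finset.mul_sum, ← Finset.sum_add_distrib]
    refine Finset.sum_congr rfl fun c _ => ?_
    by_cases h1 : IsColumn (fun i => G i.succ) c <;>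
      by_cases h2 : ∀ i, c i ≠ some StSymbol.alpha <;> simp [h1, h2, mul_assoc]
  · simp only [h0, if_false, Finset.mul_sum, add_zero]
    refine Finset.sum_congr rfl fun c _ => ?_
    by_cases h1 : IsColumn (fun i => G i.succ) c <;>
      by_cases h2 : ∀ i, c i ≠ some StSymbol.alpha <;> simp [h1, h2]

open Classical in
lemma sumAlpha_succ (G : Fin (n + 2) → Prop) (g : (Fin (n + 2) → Option StSymbol) → ℝ) :
    sumAlpha b G g =
      (if G 0 then b else 1) * sumAlpha b (fun i => G i.succ) (fun c => g (Fin.cons none c)) +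
      (if G 0 then b * sumNoAlpha b (fun i => G i.succ) (fun c => g (Fin.cons (some .alpha) c))
        else 0) := by
  simp only [sumAlpha, sumNoAlpha, sum_column_succ, isColumn_cons_none, isColumn_cons_some,
    rowWeight_cons, Fin.exists_fin_succ, Fin.cons_zero, Fin.cons_succ]
  by_cases h0 : G 0
  · simp only [h0, if_true, Finset.mul_sum, ← Finset.sum_add_distrib]
    refine Finset.sum_congr rfl fun c _ => ?_
    by_cases h1 : IsColumn (fun i => G i.succ) c <;>
      by_cases h2 : ∀ i, c i ≠ some StSymbol.alpha <;> simp [h1, h2, mul_assoc]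
  · simp only [h0, if_false, Finset.mul_sum, add_zero]
    refine Finset.sum_congr rfl fun c _ => ?_
    by_cases h1 : IsColumn (fun i => G i.succ) c <;>
      by_cases h2 : ∀ i, c i ≠ some StSymbol.alpha <;> simp [h1, h2]

lemma sum_column_one (g : (Fin 1 → Option StSymbol) → ℝ) :
    ∑ c, g c = g (fun _ => none) + g (fun _ => some .alpha) + g (fun _ => some .beta) := by
  rw [← (Equiv.funUnique (Fin 1) (Option StSymbol)).symm.sum_comp, Fintype.sum_option]
  have : (Finset.univ : Finset StSymbol) = {.alpha, .beta} := rfl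
  rw [this, Finset.sum_pair (by simp), add_assoc]
  rfl

lemma isColumn_one (G : Fin 1 → Prop) (o : Option StSymbol) :
    IsColumn G (fun _ => o) ↔ o ≠ none ∧ G 0 := by
  constructor
  · rintro ⟨h1, h2, _⟩
    exact ⟨h1, h2 0 h1⟩
  · rintro ⟨h1, h2⟩
    refine ⟨h1, fun i _ => by rwa [Fin.fin_one_eq_zero i], fun i _ i' hi' => ?_⟩
    omega

lemma sumNoAlpha_one (G : Fin 1 → Prop) (hG : G 0) (g : (Fin 1 → Option StSymbol) → ℝ) :
    sumNoAlpha b G g = g (fun _ => some .beta) := by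
  simp [sumNoAlpha, sum_column_one, isColumn_one, rowWeight, hG]

lemma sumAlpha_one (G : Fin 1 → Prop) (hG : G 0) (g : (Fin 1 → Option StSymbol) → ℝ) :
    sumAlpha b G g = b * g (fun _ => some .alpha) := by
  simp [sumAlpha, sum_column_one, isColumn_one, rowWeight, hG]

open Classical in
lemma availCount_succ (G : Fin (n + 2) → Prop) :
    availCount G = (if G 0 then 1 else 0) + availCount (fun i => G i.succ) := by
  simp only [availCount, Finset.card_filter, Fin.sum_univ_succ]
  simp
  congr

/-- Independently, each available row above the bottom is empty (weight `b`) or holds β (weight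
`1`); the bottom box must hold β. -/
lemma sumNoAlpha_total (G : Fin (n + 1) → Prop) (hG : G (Fin.last n)) :
    sumNoAlpha b G (fun _ => 1) = (b + 1) ^ availCount G := by
  induction n with
  | zero => simp [sumNoAlpha_one G hG, availCount]
  | succ n ih =>
    rw [sumNoAlpha_succ, availCount_succ, ih _ (by simpa using hG)]
    split_ifs <;> ring

/-- An α is the topmost symbol of its column. Changing it to β is a bijection onto the columns
without α, and the α keeps its row free, which accounts for the factor `b`. -/
lemma sumAlpha_total (G : Fin (n + 1) → Prop) (hG : G (Fin.last n)) :
    sumAlpha b G (fun _ => 1) = b * (b + 1) ^ availCount G := by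
  induction n with
  | zero => simp [sumAlpha_one G hG, availCount]
  | succ n ih =>
    rw [sumAlpha_succ, availCount_succ, ih _ (by simpa using hG),
      sumNoAlpha_total _ (by simpa using hG)]
    split_ifs <;> ring

lemma sumNoAlpha_zero (G : Fin (n + 1) → Prop) : sumNoAlpha b G (fun _ => 0) = 0 := by
  simp [sumNoAlpha]

lemma sumAlpha_zero (G : Fin (n + 1) → Prop) : sumAlpha b G (fun _ => 0) = 0 := by
  simp [sumAlpha]

open Classical in
lemma sumNoAlpha_nonempty (G : Fin (n + 1) → Prop) (hG : G (Fin.last n)) (h : Fin n) :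
    (b + 1) * sumNoAlpha b G (fun c => if c h.castSucc ≠ none then 1 else 0) =
      if G h.castSucc then (b + 1) ^ availCount G else 0 := by
  induction n with
  | zero => exact h.elim0
  | succ n ih =>
    rw [sumNoAlpha_succ, availCount_succ]
    cases h using Fin.cases with
    | zero =>
      simp [sumNoAlpha_zero, sumNoAlpha_total (fun i => G i.succ) (by simpa using hG)]
      split_ifs <;> ring
    | succ h =>
      simp only [Fin.castSucc_succ, Fin.cons_succ]
      have h1 := ih (fun i => G i.succ) (by simpa using hG) h
      by_cases hh : G h.castSucc.succ <;> by_cases h0 : G 0 <;>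
        simp only [hh, h0, if_true, if_false] at h1 ⊢
      · linear_combination (b + 1) * h1
      · linear_combination h1
      · linear_combination (b + 1) * h1
      · linear_combination h1

open Classical in
lemma sumAlpha_nonempty (G : Fin (n + 1) → Prop) (hG : G (Fin.last n)) (h : Fin n) :
    (b + 1) * sumAlpha b G (fun c => if c h.castSucc ≠ none then 1 else 0) =
      if G h.castSucc then b * (b + 1) ^ availCount G else 0 := by
  induction n with
  | zero => exact h.elim0
  | succ n ih =>
    rw [sumAlpha_succ, availCount_succ]
    cases h using Fin.cases with
    | zero =>
      simp [sumAlpha_zero, sumNoAlpha_total (fun i => G i.succ) (by simpa using hG)]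
      split_ifs <;> ring
    | succ h =>
      simp only [Fin.castSucc_succ, Fin.cons_succ]
      have h1 := ih (fun i => G i.succ) (by simpa using hG) h
      have h2 := sumNoAlpha_nonempty (b := b) (fun i => G i.succ) (by simpa using hG) h
      by_cases hh : G h.castSucc.succ <;> by_cases h0 : G 0 <;>
        simp only [hh, h0, if_true, if_false] at h1 h2 ⊢
      · linear_combination b * h1 + b * h2
      · linear_combination h1
      · linear_combination b * h1 + b * h2
      · linear_combination h1

/-- The number of available rows weakly above the row `h`. -/
noncomputable def availAbove (G : Fin (n + 1) → Prop) (h : Fin n) : ℕ := by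
  classical exact (Finset.univ.filter fun i : Fin n => i ≤ h ∧ G i.castSucc).card

open Classical in
-- The row of the α and each available row above it, which must be empty, contribute `b`; the
-- available rows below are unconstrained. The power of `b + 1` on the left replaces a subtraction
-- of exponents on the right.
lemma sumAlpha_alpha (G : Fin (n + 1) → Prop) (hG : G (Fin.last n)) (h : Fin n) :
    (b + 1) ^ availAbove G h *
      sumAlpha b G (fun c => if c h.castSucc = some .alpha then 1 else 0) =
      if G h.castSucc then b ^ availAbove G h * (b + 1) ^ availCount G else 0 := by
  induction n with
  | zero => exact h.elim0
  | succ n ih =>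
    rw [sumAlpha_succ, availCount_succ]
    cases h using Fin.cases with
    | zero =>
      have : availAbove G 0 = if G 0 then 1 else 0 := by
        simp only [availAbove, Finset.card_filter, Fin.sum_univ_succ]
        simp
      rw [this]
      simp [sumAlpha_zero, sumNoAlpha_total (fun i => G i.succ) (by simpa using hG)]
      split_ifs <;> ring
    | succ h =>
      have : availAbove G h.succ = (if G 0 then 1 else 0) + availAbove (fun i => G i.succ) h := by
        simp only [availAbove, Finset.card_filter, Fin.sum_univ_succ]
        simp
      rw [this]
      simp only [Fin.castSucc_succ, Fin.cons_succ]
      have h1 := ih (fun i => G i.succ) (by simpa using hG) h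
      have h2 : sumNoAlpha b (fun i => G i.succ)
          (fun c => if c h.castSucc = some .alpha then 1 else 0) = 0 := by
        refine Finset.sum_eq_zero fun c _ => ?_
        split_ifs with h3
        · simp [h3.2]
        · rfl
      rw [h2]
      by_cases h0 : G 0
      · simp only [h0, if_true, mul_zero, add_zero]
        rw [pow_add, pow_one]
        calc _ = (b + 1) * b * ((b + 1) ^ availAbove (fun i => G i.succ) h *
              sumAlpha b (fun i => G i.succ)
                (fun c => if c h.castSucc = some .alpha then 1 else 0)) := by ring
          _ = _ := by rw [h1]; split_ifs <;> ring
      · simpa [h0] using h1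

open Classical in
lemma sumNoAlpha_bottom (G : Fin (n + 1) → Prop) (g : (Fin (n + 1) → Option StSymbol) → ℝ) :
    sumNoAlpha b G (fun c => if c (Fin.last n) = some .alpha then g c else 0) = 0 := by
  refine Finset.sum_eq_zero fun c _ => ?_
  split_ifs with h3
  · simp [h3.2]
  · rfl

open Classical in
-- An α at the bottom empties the rest of the column; the extra `1` in the exponent is the bottom
-- row itself.
lemma sumAlpha_bottom (G : Fin (n + 1) → Prop) (hG : G (Fin.last n)) :
    sumAlpha b G (fun c => if c (Fin.last n) = some .alpha then 1 else 0) =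
      b ^ (availCount G + 1) := by
  induction n with
  | zero => simp [sumAlpha_one G hG, availCount]
  | succ n ih =>
    rw [sumAlpha_succ, availCount_succ]
    simp only [← Fin.succ_last, Fin.cons_succ]
    rw [sumNoAlpha_bottom, ih _ (by simpa using hG)]
    split_ifs <;> ring

end Column

namespace StaircaseTableau

/-! ### Adding a column to the left of a tableau -/

section Cons

variable {n : ℕ}

/-- A row is free if it contains no `β`. -/
def freeRow (S : StaircaseTableau n) (i : Fin n) : Prop := ∀ j, S.1 i j ≠ some .beta

/-- The rows in which a new first column may contain a symbol: the free ones and the new one. -/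
def availRow (S : StaircaseTableau n) (i : Fin (n + 1)) : Prop :=
  ∀ h : (i : ℕ) < n, S.freeRow ⟨i, h⟩

lemma availRow_last (S : StaircaseTableau n) : S.availRow (Fin.last n) := fun h =>
  absurd h (by simp)

lemma availRow_castSucc (S : StaircaseTableau n) (i : Fin n) :
    S.availRow i.castSucc ↔ S.freeRow i :=
  ⟨fun h => h i.2, fun h _ => h⟩

/-- The columns that can be added to the left of `S`. -/
def Col (S : StaircaseTableau n) : Type :=
  {c : Fin (n + 1) → Option StSymbol // IsColumn S.availRow c}

noncomputable instance (S : StaircaseTableau n) : Fintype S.Col := by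
  classical exact inferInstanceAs (Fintype {c // IsColumn S.availRow c})

/-- The tableau obtained from `S` by adding the column `c` on the left. -/
def cons (S : StaircaseTableau n) (c : S.Col) : StaircaseTableau (n + 1) :=
  ⟨fun i j => Fin.cases (motive := fun _ => Option StSymbol) (c.1 i)
      (fun j => if h : (i : ℕ) < n then S.1 ⟨i, h⟩ j else none) j, by
    refine ⟨fun i j hij => ?_, fun i j hij => ?_, fun i j hij i' hi' => ?_,
      fun i j hij j' hj' => ?_⟩
    · cases j using Fin.cases with
      | zero => simp at hij; omega
      | succ j =>
        simp only [Fin.cases_succ]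
        split_ifs with h
        · exact S.2.outside _ _ (by simp at hij ⊢; omega)
        · rfl
    · cases j using Fin.cases with
      | zero =>
        have : i = Fin.last n := by ext; simpa using hij
        subst this
        exact c.2.bottom
      | succ j =>
        have h : (i : ℕ) < n := by simp at hij; omega
        simp only [Fin.cases_succ, h, dif_pos]
        exact S.2.diagonal _ _ (by simp at hij ⊢; omega)
    · cases j using Fin.cases with
      | zero => exact c.2.north i hij i' hi'
      | succ j =>
        simp only [Fin.cases_succ] at hij ⊢
        split_ifs at hij with h
        have h' : (i' : ℕ) < n := lt_trans hi' h
        rw [dif_pos h']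
        exact S.2.north_alpha _ _ hij _ hi'
    · cases j using Fin.cases with
      | zero => simp at hj'
      | succ j =>
        simp only [Fin.cases_succ] at hij
        split_ifs at hij with h
        cases j' using Fin.cases with
        | zero =>
          by_contra hc
          exact c.2.avail i hc h j hij
        | succ j' =>
          simp only [Fin.cases_succ, h, dif_pos]
          exact S.2.west_beta _ _ hij _ (by simpa using hj')⟩

@[simp] lemma cons_zero (S : StaircaseTableau n) (c : S.Col) (i : Fin (n + 1)) :
    (S.cons c).1 i 0 = c.1 i := rfl

@[simp] lemma cons_castSucc_succ (S : StaircaseTableau n) (c : S.Col) (i j : Fin n) :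
    (S.cons c).1 i.castSucc j.succ = S.1 i j := by
  simp [cons]

@[simp] lemma cons_last_succ (S : StaircaseTableau n) (c : S.Col) (j : Fin n) :
    (S.cons c).1 (Fin.last n) j.succ = none := by
  simp [cons]

/-- Removing the first column. -/
def tail (S : StaircaseTableau (n + 1)) : StaircaseTableau n :=
  ⟨fun i j => S.1 i.castSucc j.succ,
    fun i j h => S.2.outside _ _ (by simp; omega),
    fun i j h => S.2.diagonal _ _ (by simp; omega),
    fun i j h i' hi' => S.2.north_alpha _ _ h _ (by simpa using hi'),
    fun i j h j' hj' => S.2.west_beta _ _ h _ (by simpa using hj')⟩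

lemma isColumn_head (S : StaircaseTableau (n + 1)) :
    IsColumn S.tail.availRow (fun i => S.1 i 0) where
  bottom := S.2.diagonal _ _ (by simp)
  avail i hi h j hj := hi (S.2.west_beta i j.succ hj 0 (by simp))
  north i hi i' hi' := S.2.north_alpha i 0 hi i' hi'

/-- A tableau is a smaller tableau together with a column added to the left of it. -/
def consEquiv (n : ℕ) : (Σ S : StaircaseTableau n, S.Col) ≃ StaircaseTableau (n + 1) where
  toFun p := p.1.cons p.2
  invFun S := ⟨S.tail, ⟨fun i => S.1 i 0, S.isColumn_head⟩⟩
  left_inv := by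
    rintro ⟨S, c, hc⟩
    have h : (S.cons ⟨c, hc⟩).tail = S := by
      apply Subtype.ext
      funext i j
      exact cons_castSucc_succ S ⟨c, hc⟩ i j
    refine Sigma.ext h ?_
    -- Generalising over the base tableau allows the equation `h` to be substituted away in the
    -- dependent component.
    have key : ∀ (S' : StaircaseTableau n) (h : S' = S) (hc' : IsColumn S'.availRow c),
        HEq (⟨c, hc'⟩ : S'.Col) (⟨c, hc⟩ : S.Col) := by
      rintro S' rfl hc'
      rfl
    exact key _ h _
  right_inv := by
    intro S
    apply Subtype.ext
    funext i j
    cases j using Fin.cases with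
    | zero => rfl
    | succ j =>
      cases i using Fin.lastCases with
      | last =>
        rw [cons_last_succ]
        exact (S.2.outside _ _ (by simp)).symm
      | cast i => exact cons_castSucc_succ _ _ i j

lemma freeRow_cons (S : StaircaseTableau n) (c : S.Col) (i : Fin (n + 1)) :
    (S.cons c).freeRow i ↔ S.availRow i ∧ c.1 i ≠ some .beta := by
  unfold freeRow
  rw [Fin.forall_fin_succ, and_comm, cons_zero]
  refine and_congr_left fun _ => ?_
  cases i using Fin.lastCases with
  | last => simp [availRow_last]
  | cast i => simp [availRow_castSucc, freeRow]

/-- The number of rows without `β`. -/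
noncomputable def freeCount (S : StaircaseTableau n) : ℕ := by
  classical exact (Finset.univ.filter S.freeRow).card

/-- The number of columns without `α`. -/
noncomputable def freeColCount (S : StaircaseTableau n) : ℕ := by
  classical exact (Finset.univ.filter fun j => ∀ i, S.1 i j ≠ some .alpha).card

lemma availCount_availRow (S : StaircaseTableau n) : availCount S.availRow = S.freeCount := by
  unfold availCount freeCount
  congr 1
  ext i
  simp [availRow_castSucc]

lemma pow_freeCount_cons (S : StaircaseTableau n) (c : S.Col) (b : ℝ) :
    b ^ (S.cons c).freeCount = rowWeight b S.availRow c.1 := by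
  classical
  rw [rowWeight, Finset.prod_ite, Finset.prod_const, Finset.prod_const_one, mul_one, freeCount]
  congr 2
  ext i
  simp [freeRow_cons]

open Classical in
lemma freeColCount_cons (S : StaircaseTableau n) (c : S.Col) :
    (S.cons c).freeColCount =
      S.freeColCount + if ∃ i, c.1 i = some .alpha then 0 else 1 := by
  simp only [freeColCount, Finset.card_filter]
  rw [Fin.sum_univ_succ, add_comm]
  congr 1
  · refine Finset.sum_congr rfl fun j _ => ?_
    simp [Fin.forall_fin_succ']
  · simp only [cons_zero, ← not_exists, ite_not]

lemma diagCount_cons (S : StaircaseTableau n) (c : S.Col) (k : ℕ) (x : StSymbol) :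
    (S.cons c).diagCount k x = S.diagCount k x +
      (Finset.univ.filter fun i : Fin (n + 1) => (i : ℕ) + k = n + 1 ∧ c.1 i = some x).card := by
  simp only [diagCount, Finset.card_filter, Fintype.sum_prod_type_right]
  rw [Fin.sum_univ_succ, add_comm]
  congr 1
  refine Finset.sum_congr rfl fun j _ => ?_
  rw [Fin.sum_univ_castSucc]
  simp only [cons_castSucc_succ, cons_last_succ]
  simp only [reduceCtorEq, and_false, if_false, add_zero]
  refine Finset.sum_congr rfl fun i _ => ?_
  have : ((i.castSucc : Fin (n + 1)) : ℕ) + ((j.succ : Fin (n + 1)) : ℕ) + k = n + 1 ↔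
    (i : ℕ) + j + k = n := by simp; omega
  simp only [this]

end Cons

/-! ### Averages over tableaux -/

section Average

variable {n : ℕ} {E : Type*} [NormedAddCommGroup E] [NormedSpace ℝ E]

/-- The weight of a tableau in terms of `a = 1 / α` and `b = 1 / β`, up to a constant. -/
noncomputable def dualWeight (a b : ℝ) (S : StaircaseTableau n) : ℝ :=
  a ^ S.freeColCount * b ^ S.freeCount

/-- The factor by which a column changes the weight. -/
noncomputable def colWeight (a b : ℝ) (S : StaircaseTableau n) (c : S.Col) : ℝ := by
  classical
  exact (if ∃ i, c.1 i = some .alpha then 1 else a) * rowWeight b S.availRow c.1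

lemma dualWeight_cons (a b : ℝ) (S : StaircaseTableau n) (c : S.Col) :
    (S.cons c).dualWeight a b = a ^ S.freeColCount * colWeight a b S c := by
  classical
  rw [dualWeight, colWeight, freeColCount_cons, pow_freeCount_cons, pow_add, mul_assoc]
  split_ifs <;> simp

/-- The total weight of the tableaux of size `n`. -/
noncomputable def dualPartition (n : ℕ) (a b : ℝ) : ℝ := ∏ i ∈ Finset.range n, (a + b + i)

lemma dualPartition_succ (n : ℕ) (a b : ℝ) :
    dualPartition (n + 1) a b = (a + b) * dualPartition n a (b + 1) := by
  rw [dualPartition, Finset.prod_range_succ', mul_comm, dualPartition]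
  congr 1
  · simp
  · exact Finset.prod_congr rfl fun i _ => by push_cast; ring

/-- The average of `Φ` over the columns that can be added to `S`. -/
noncomputable def colAvg (a b : ℝ) (S : StaircaseTableau n) (Φ : S.Col → E) : E :=
  ∑ c, (colWeight a b S c / ((a + b) * (b + 1) ^ S.freeCount)) • Φ c

/-- The average of `Φ` over the tableaux of size `n` with parameters `1 / a` and `1 / b`. -/
noncomputable def avg (a b : ℝ) (Φ : StaircaseTableau n → E) : E :=
  ∑ S, (S.dualWeight a b / dualPartition n a b) • Φ S

lemma sum_cons {E : Type*} [AddCommMonoid E] (Φ : StaircaseTableau (n + 1) → E) :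
    ∑ S, Φ S = ∑ S : StaircaseTableau n, ∑ c : S.Col, Φ (S.cons c) := by
  rw [← (consEquiv n).sum_comp, ← Finset.univ_sigma_univ, Finset.sum_sigma]
  rfl

/-- The columns over `S` have total weight `(a + b) * (b + 1) ^ S.freeCount`, which reweights `S` by
`dualWeight a (b + 1)`. This is the Markov property on which everything rests. -/
lemma avg_succ {a b : ℝ} (hb : 0 < b) (Φ : StaircaseTableau (n + 1) → E) :
    avg a b Φ = avg a (b + 1) fun S => colAvg a b S fun c => Φ (S.cons c) := by
  rw [avg, sum_cons, avg]
  refine Finset.sum_congr rfl fun S _ => ?_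
  rw [colAvg, Finset.smul_sum]
  refine Finset.sum_congr rfl fun c _ => ?_
  rw [smul_smul, dualWeight_cons, dualPartition_succ, dualWeight]
  congr 1
  have : (b + 1) ^ S.freeCount ≠ 0 := by positivity
  rw [div_mul_div_comm, mul_comm (dualPartition n a (b + 1)), mul_right_comm (a + b),
    mul_right_comm (a ^ S.freeColCount), mul_div_mul_right _ _ this]

open Classical in
lemma sum_colWeight (a b : ℝ) (S : StaircaseTableau n)
    (g : (Fin (n + 1) → Option StSymbol) → ℝ) :
    ∑ c : S.Col, colWeight a b S c * g c.1 =
      a * sumNoAlpha b S.availRow g + sumAlpha b S.availRow g := by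
  have : ∑ c : S.Col, colWeight a b S c * g c.1 =
      ∑ c ∈ Finset.univ.filter fun c => IsColumn S.availRow c,
        (if ∃ i, c i = some StSymbol.alpha then 1 else a) * rowWeight b S.availRow c * g c :=
    (Finset.sum_subtype (p := fun c => IsColumn S.availRow c) _ (by simp)
      (fun c => (if ∃ i, c i = some StSymbol.alpha then 1 else a) *
        rowWeight b S.availRow c * g c)).symm
  rw [this, Finset.sum_filter, sumNoAlpha, sumAlpha, Finset.mul_sum, ← Finset.sum_add_distrib]
  refine Finset.sum_congr rfl fun c _ => ?_
  by_cases h1 : IsColumn S.availRow c <;> by_cases h2 : ∃ i, c i = some StSymbol.alpha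
  · simp [h1, h2]
  · have h3 : ∀ i, c i ≠ some StSymbol.alpha := by simpa using h2
    simp [h1, h3, mul_assoc]
  all_goals simp [h1]

lemma rowWeight_mul (b r : ℝ) (G : Fin (n + 1) → Prop) (c : Fin (n + 1) → Option StSymbol) :
    rowWeight b G c * rowWeight r G c = rowWeight (b * r) G c := by
  classical
  simp only [rowWeight, ← Finset.prod_mul_distrib]
  refine Finset.prod_congr rfl fun i _ => ?_
  split_ifs <;> simp

lemma colWeight_mul_pow (a b r : ℝ) (S : StaircaseTableau n) (c : S.Col) :
    colWeight a b S c * r ^ (S.cons c).freeCount = colWeight a (b * r) S c := by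
  rw [pow_freeCount_cons, colWeight, colWeight, mul_assoc, rowWeight_mul]

lemma sum_colWeight_one (a b : ℝ) (S : StaircaseTableau n) :
    ∑ c : S.Col, colWeight a b S c = (a + b) * (b + 1) ^ S.freeCount := by
  have := sum_colWeight a b S fun _ => 1
  simp only [mul_one] at this
  rw [this, sumNoAlpha_total _ S.availRow_last, sumAlpha_total _ S.availRow_last,
    availCount_availRow]
  ring

lemma sum_dualWeight (n : ℕ) (a b : ℝ) :
    ∑ S : StaircaseTableau n, S.dualWeight a b = dualPartition n a b := by
  induction n generalizing b with
  | zero =>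
    have : ∀ S : StaircaseTableau 0, S.dualWeight a b = 1 := fun S => by
      simp [dualWeight, freeColCount, freeCount]
    have hu : Unique (StaircaseTableau 0) :=
      { default := ⟨fun i => i.elim0, ⟨fun i => i.elim0, fun i => i.elim0, fun i => i.elim0,
          fun i => i.elim0⟩⟩
        uniq := fun S => Subtype.ext (funext fun i => i.elim0) }
    simp only [this, dualPartition, Finset.range_zero, Finset.prod_empty, Finset.sum_const,
      Finset.card_univ, Fintype.card_unique, one_smul]
  | succ n ih =>
    rw [sum_cons, dualPartition_succ, ← ih, Finset.mul_sum]
    refine Finset.sum_congr rfl fun S _ => ?_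
    simp only [dualWeight_cons, ← Finset.mul_sum, sum_colWeight_one]
    rw [dualWeight]
    ring

lemma dualWeight_mul_pow (a b r : ℝ) (S : StaircaseTableau n) :
    S.dualWeight a b * r ^ S.freeCount = S.dualWeight a (b * r) := by
  rw [dualWeight, dualWeight, mul_pow, mul_assoc]

/-- The factor `r ^ freeCount` merely changes `b` into `b * r` in the weight. By the product
formula, `freeCount` is thus distributed as a sum of independent Bernoulli variables with means `b /
(a + b + i)`. -/
lemma avg_pow_freeCount (a b r : ℝ) :
    avg a b (fun S : StaircaseTableau n => r ^ S.freeCount) =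
      dualPartition n a (b * r) / dualPartition n a b := by
  simp only [avg, smul_eq_mul, div_mul_eq_mul_div, dualWeight_mul_pow, ← Finset.sum_div,
    sum_dualWeight]

lemma colAvg_pow_freeCount (a b r : ℝ) (S : StaircaseTableau n) :
    colAvg a b S (fun c => r ^ (S.cons c).freeCount) =
      (a + b * r) * (b * r + 1) ^ S.freeCount / ((a + b) * (b + 1) ^ S.freeCount) := by
  simp only [colAvg, smul_eq_mul, div_mul_eq_mul_div, colWeight_mul_pow, ← Finset.sum_div,
    sum_colWeight_one]

lemma colAvg_real (a b : ℝ) (S : StaircaseTableau n) (g : (Fin (n + 1) → Option StSymbol) → ℝ) :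
    colAvg a b S (fun c => g c.1) =
      (a * sumNoAlpha b S.availRow g + sumAlpha b S.availRow g) /
        ((a + b) * (b + 1) ^ S.freeCount) := by
  simp only [colAvg, smul_eq_mul, div_mul_eq_mul_div, ← Finset.sum_div, sum_colWeight]

open Classical in
/-- A given box of the new column above the bottom one is filled with probability `1 / (b + 1)`
if its row is free. -/
lemma colAvg_nonempty {a b : ℝ} (ha : 0 < a) (hb : 0 < b) (S : StaircaseTableau n) (h : Fin n) :
    colAvg a b S (fun c => if c.1 h.castSucc ≠ none then (1 : ℝ) else 0) =
      if S.freeRow h then 1 / (b + 1) else 0 := by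
  rw [colAvg_real a b S fun c => if c h.castSucc ≠ none then (1 : ℝ) else 0]
  have h1 := sumNoAlpha_nonempty (b := b) _ S.availRow_last h
  have h2 := sumAlpha_nonempty (b := b) _ S.availRow_last h
  rw [availRow_castSucc, availCount_availRow] at h1 h2
  rw [div_eq_iff (by positivity)]
  split_ifs at h1 h2 ⊢
  · field_simp
    linear_combination a * h1 + h2
  · have hb' : b + 1 ≠ 0 := by positivity
    apply mul_left_cancel₀ hb'
    linear_combination a * h1 + h2

/-- The number of free rows weakly above the row `h`. -/
noncomputable def freeAbove (S : StaircaseTableau n) (h : Fin n) : ℕ := by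
  classical exact (Finset.univ.filter fun i : Fin n => i ≤ h ∧ S.freeRow i).card

open Classical in
lemma colAvg_alpha {a b : ℝ} (ha : 0 < a) (hb : 0 < b) (S : StaircaseTableau n) (h : Fin n) :
    colAvg a b S (fun c => if c.1 h.castSucc = some .alpha then (1 : ℝ) else 0) =
      if S.freeRow h then (b / (b + 1)) ^ S.freeAbove h / (a + b) else 0 := by
  rw [colAvg_real a b S fun c => if c h.castSucc = some .alpha then (1 : ℝ) else 0]
  have h1 : sumNoAlpha b S.availRow
      (fun c => if c h.castSucc = some .alpha then (1 : ℝ) else 0) = 0 := by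
    refine Finset.sum_eq_zero fun c _ => ?_
    split_ifs with h3
    · simp [h3.2]
    · rfl
  have h2 := sumAlpha_alpha (b := b) _ S.availRow_last h
  have h3 : availAbove S.availRow h = S.freeAbove h := by
    simp only [availAbove, freeAbove, availRow_castSucc]
  rw [availRow_castSucc, availCount_availRow, h3] at h2
  rw [h1, div_eq_iff (by positivity), mul_zero, zero_add]
  apply mul_left_cancel₀ (show (b + 1) ^ S.freeAbove h ≠ 0 by positivity)
  rw [h2]
  split_ifs
  · rw [div_pow]
    field_simp
  · simp

open Classical in
lemma colAvg_bottom_alpha_mul_pow (a b r : ℝ) (S : StaircaseTableau n) :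
    colAvg a b S (fun c => if c.1 (Fin.last n) = some .alpha then
        r ^ (S.cons c).freeCount else (0 : ℝ)) =
      (b * r) ^ (S.freeCount + 1) / ((a + b) * (b + 1) ^ S.freeCount) := by
  have h : colAvg a b S (fun c => if c.1 (Fin.last n) = some .alpha then
        r ^ (S.cons c).freeCount else (0 : ℝ)) =
      (∑ c : S.Col, colWeight a (b * r) S c *
        if c.1 (Fin.last n) = some .alpha then 1 else 0) /
          ((a + b) * (b + 1) ^ S.freeCount) := by
    rw [colAvg, Finset.sum_div]
    refine Finset.sum_congr rfl fun c _ => ?_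
    rw [← colWeight_mul_pow, smul_eq_mul]
    split_ifs
    · ring
    · simp
  rw [h, sum_colWeight a (b * r) S fun c => if c (Fin.last n) = some .alpha then 1 else 0,
    sumNoAlpha_bottom, sumAlpha_bottom _ S.availRow_last, availCount_availRow]
  ring

lemma colWeight_nonneg {a b : ℝ} (ha : 0 < a) (hb : 0 < b) (S : StaircaseTableau n)
    (c : S.Col) : 0 ≤ colWeight a b S c := by
  classical
  rw [colWeight, ← pow_freeCount_cons]
  split_ifs <;> positivity

lemma dualPartition_pos {a b : ℝ} (ha : 0 < a) (hb : 0 < b) : 0 < dualPartition n a b :=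
  Finset.prod_pos fun i _ => by positivity

lemma dualWeight_nonneg {a b : ℝ} (ha : 0 < a) (hb : 0 < b) (S : StaircaseTableau n) :
    0 ≤ S.dualWeight a b := by
  rw [dualWeight]
  positivity

end Average

end StaircaseTableau

/-! ### Elementary properties of the averages -/

namespace StaircaseTableau

section AverageLemmas

variable {n : ℕ} {E : Type*} [NormedAddCommGroup E] [NormedSpace ℝ E] {a b : ℝ}

lemma colProb_nonneg (ha : 0 < a) (hb : 0 < b) (S : StaircaseTableau n) (c : S.Col) :
    0 ≤ colWeight a b S c / ((a + b) * (b + 1) ^ S.freeCount) :=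
  div_nonneg (colWeight_nonneg ha hb S c) (by positivity)

lemma dualProb_nonneg (ha : 0 < a) (hb : 0 < b) (S : StaircaseTableau n) :
    0 ≤ S.dualWeight a b / dualPartition n a b :=
  div_nonneg (dualWeight_nonneg ha hb S) (dualPartition_pos ha hb).le

lemma sum_dualProb (ha : 0 < a) (hb : 0 < b) :
    ∑ S : StaircaseTableau n, S.dualWeight a b / dualPartition n a b = 1 := by
  rw [← Finset.sum_div, sum_dualWeight, div_self (dualPartition_pos ha hb).ne']

lemma colAvg_const (ha : 0 < a) (hb : 0 < b) (S : StaircaseTableau n) (v : E) :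
    colAvg a b S (fun _ => v) = v := by
  rw [colAvg, ← Finset.sum_smul, ← Finset.sum_div, sum_colWeight_one,
    div_self (by positivity), one_smul]

lemma avg_const (ha : 0 < a) (hb : 0 < b) (v : E) :
    avg a b (fun _ : StaircaseTableau n => v) = v := by
  rw [avg, ← Finset.sum_smul, sum_dualProb ha hb, one_smul]

lemma norm_colAvg_le (ha : 0 < a) (hb : 0 < b) (S : StaircaseTableau n) (Φ : S.Col → E) :
    ‖colAvg a b S Φ‖ ≤ colAvg a b S fun c => ‖Φ c‖ := by
  refine (norm_sum_le _ _).trans_eq (Finset.sum_congr rfl fun c _ => ?_)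
  rw [norm_smul, Real.norm_of_nonneg (colProb_nonneg ha hb S c), smul_eq_mul]

lemma norm_avg_le (ha : 0 < a) (hb : 0 < b) (Φ : StaircaseTableau n → E) :
    ‖avg a b Φ‖ ≤ avg a b fun S => ‖Φ S‖ := by
  refine (norm_sum_le _ _).trans_eq (Finset.sum_congr rfl fun S _ => ?_)
  rw [norm_smul, Real.norm_of_nonneg (dualProb_nonneg ha hb S), smul_eq_mul]

lemma colAvg_mono (ha : 0 < a) (hb : 0 < b) (S : StaircaseTableau n) {Φ Ψ : S.Col → ℝ}
    (h : ∀ c, Φ c ≤ Ψ c) : colAvg a b S Φ ≤ colAvg a b S Ψ :=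
  Finset.sum_le_sum fun c _ => mul_le_mul_of_nonneg_left (h c) (colProb_nonneg ha hb S c)

lemma avg_mono (ha : 0 < a) (hb : 0 < b) {Φ Ψ : StaircaseTableau n → ℝ}
    (h : ∀ S, Φ S ≤ Ψ S) : avg a b Φ ≤ avg a b Ψ :=
  Finset.sum_le_sum fun S _ => mul_le_mul_of_nonneg_left (h S) (dualProb_nonneg ha hb S)

lemma colAvg_add (S : StaircaseTableau n) (Φ Ψ : S.Col → E) :
    colAvg a b S (fun c => Φ c + Ψ c) = colAvg a b S Φ + colAvg a b S Ψ := by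
  simp only [colAvg, smul_add, Finset.sum_add_distrib]

lemma colAvg_sub (S : StaircaseTableau n) (Φ Ψ : S.Col → E) :
    colAvg a b S (fun c => Φ c - Ψ c) = colAvg a b S Φ - colAvg a b S Ψ := by
  simp only [colAvg, smul_sub, Finset.sum_sub_distrib]

lemma avg_add (Φ Ψ : StaircaseTableau n → E) :
    avg a b (fun S => Φ S + Ψ S) = avg a b Φ + avg a b Ψ := by
  simp only [avg, smul_add, Finset.sum_add_distrib]

lemma avg_sub (Φ Ψ : StaircaseTableau n → E) :
    avg a b (fun S => Φ S - Ψ S) = avg a b Φ - avg a b Ψ := by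
  simp only [avg, smul_sub, Finset.sum_sub_distrib]

lemma colAvg_mul_left {A : Type*} [NormedRing A] [NormedAlgebra ℝ A] (S : StaircaseTableau n)
    (v : A) (Φ : S.Col → A) : colAvg a b S (fun c => v * Φ c) = v * colAvg a b S Φ := by
  simp only [colAvg, Finset.mul_sum, mul_smul_comm]

lemma avg_mul_left {A : Type*} [NormedRing A] [NormedAlgebra ℝ A]
    (v : A) (Φ : StaircaseTableau n → A) : avg a b (fun S => v * Φ S) = v * avg a b Φ := by
  simp only [avg, Finset.mul_sum, mul_smul_comm]

lemma colAvg_ofReal (S : StaircaseTableau n) (Φ : S.Col → ℝ) :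
    colAvg a b S (fun c => (Φ c : ℂ)) = (colAvg a b S Φ : ℝ) := by
  simp [colAvg]

lemma sq_avg_le (ha : 0 < a) (hb : 0 < b) (Φ : StaircaseTableau n → ℝ) (h : ∀ S, 0 ≤ Φ S) :
    avg a b Φ ^ 2 ≤ avg a b fun S => Φ S ^ 2 := by
  simpa [avg] using Real.pow_arith_mean_le_arith_mean_pow Finset.univ
    (fun S : StaircaseTableau n => S.dualWeight a b / dualPartition n a b) Φ
    (fun S _ => dualProb_nonneg ha hb S) (sum_dualProb ha hb) (fun S _ => h S) 2

end AverageLemmas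

/-! ### Concentration of the number of free rows -/

section Concentration

variable {n : ℕ} {a b : ℝ}

lemma avg_pow_freeCount_nonneg (ha : 0 < a) (hb : 0 < b) {r : ℝ} (hr : 0 ≤ r) :
    0 ≤ avg a b fun S : StaircaseTableau n => r ^ S.freeCount := by
  rw [← avg_const (n := n) ha hb (0 : ℝ)]
  exact avg_mono ha hb fun S => by positivity

lemma avg_pow_freeCount_le_one (ha : 0 < a) (hb : 0 < b) {r : ℝ} (hr : 0 ≤ r) (hr1 : r ≤ 1) :
    avg a b (fun S : StaircaseTableau n => r ^ S.freeCount) ≤ 1 := by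
  conv_rhs => rw [← avg_const (n := n) ha hb (1 : ℝ)]
  exact avg_mono ha hb fun S => pow_le_one₀ hr hr1

lemma avg_pow_freeCount_succ (r : ℝ) :
    avg a b (fun S : StaircaseTableau (n + 1) => r ^ S.freeCount) =
      avg a b (fun S : StaircaseTableau n => r ^ S.freeCount) * ((a + b * r + n) / (a + b + n)) := by
  simp only [avg_pow_freeCount, dualPartition, Finset.prod_range_succ]
  rw [div_mul_div_comm]

/-- A variance bound read off from the product form of the mean: each factor adds at most `(1 - r) ^
2`, and all factors lie in `[0, 1]`. -/
lemma avg_pow_freeCount_sq_le (ha : 0 < a) (hb : 0 < b) {r : ℝ} (hr : 0 ≤ r) (hr1 : r ≤ 1) :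
    avg a b (fun S : StaircaseTableau n => (r ^ 2) ^ S.freeCount) ≤
      avg a b (fun S : StaircaseTableau n => r ^ S.freeCount) ^ 2 + n * (1 - r) ^ 2 := by
  induction n with
  | zero => simp [avg_pow_freeCount, dualPartition]
  | succ n ih =>
    rw [avg_pow_freeCount_succ, avg_pow_freeCount_succ]
    set X := avg a b (fun S : StaircaseTableau n => (r ^ 2) ^ S.freeCount)
    set Y := avg a b (fun S : StaircaseTableau n => r ^ S.freeCount)
    have hX0 : 0 ≤ X := avg_pow_freeCount_nonneg ha hb (by positivity)
    have hX1 : X ≤ 1 := avg_pow_freeCount_le_one ha hb (by positivity) (pow_le_one₀ hr hr1)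
    have hD : 0 < a + b + n := by positivity
    set p := b / (a + b + n) with hp
    have hp0 : 0 ≤ p := by positivity
    have hp1 : p ≤ 1 := by
      rw [hp, div_le_one hD]
      have : (0 : ℝ) ≤ n := n.cast_nonneg
      linarith
    have hx : (a + b * r ^ 2 + n) / (a + b + n) = 1 - p * (1 - r ^ 2) := by
      rw [hp]; field_simp; ring
    have hy : (a + b * r + n) / (a + b + n) = 1 - p * (1 - r) := by
      rw [hp]; field_simp; ring
    rw [hx, hy]
    have hy0 : 0 ≤ 1 - p * (1 - r) := by nlinarith
    have hy1 : 1 - p * (1 - r) ≤ 1 := by nlinarith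
    -- Without the last term the two sides differ by exactly `p * (1 - p) * (1 - r) ^ 2`.
    have hxy : 1 - p * (1 - r ^ 2) ≤ (1 - p * (1 - r)) ^ 2 + (1 - r) ^ 2 := by
      have : p * (1 - p) ≤ 1 := by nlinarith
      nlinarith [mul_le_mul_of_nonneg_right this (sq_nonneg (1 - r))]
    set y := 1 - p * (1 - r)
    have hy2 : y ^ 2 ≤ 1 := pow_le_one₀ hy0 hy1
    have hd : 0 ≤ (1 - r) ^ 2 := sq_nonneg _
    calc X * (1 - p * (1 - r ^ 2)) ≤ X * (y ^ 2 + (1 - r) ^ 2) :=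
          mul_le_mul_of_nonneg_left hxy hX0
      _ = X * y ^ 2 + X * (1 - r) ^ 2 := by ring
      _ ≤ (Y ^ 2 + n * (1 - r) ^ 2) * y ^ 2 + 1 * (1 - r) ^ 2 := by gcongr
      _ = Y ^ 2 * y ^ 2 + (n * (1 - r) ^ 2) * y ^ 2 + (1 - r) ^ 2 := by ring
      _ ≤ Y ^ 2 * y ^ 2 + (n * (1 - r) ^ 2) * 1 + (1 - r) ^ 2 := by gcongr
      _ = _ := by push_cast; ring

/-- The mean absolute deviation is at most the standard deviation. It is applied with `1 - r` of
order `1 / J`. -/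
lemma avg_abs_pow_sub_le (ha : 0 < a) (hb : 0 < b) {r : ℝ} (hr : 0 ≤ r) (hr1 : r ≤ 1) :
    avg a b (fun S : StaircaseTableau n =>
      |r ^ S.freeCount - avg a b (fun S : StaircaseTableau n => r ^ S.freeCount)|) ≤
      √n * (1 - r) := by
  set m := avg a b (fun S : StaircaseTableau n => r ^ S.freeCount) with hm
  have h1 := sq_avg_le ha hb (fun S : StaircaseTableau n => |r ^ S.freeCount - m|)
    fun S => abs_nonneg _
  have h2 : avg a b (fun S : StaircaseTableau n => |r ^ S.freeCount - m| ^ 2) =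
      avg a b (fun S : StaircaseTableau n => (r ^ 2) ^ S.freeCount) - m ^ 2 := by
    have : (fun S : StaircaseTableau n => |r ^ S.freeCount - m| ^ 2) =
        fun S => ((r ^ 2) ^ S.freeCount - (2 * m) * r ^ S.freeCount) + m ^ 2 := by
      funext S
      rw [sq_abs, ← pow_mul, mul_comm 2, pow_mul]
      ring
    rw [this, avg_add, avg_sub, avg_mul_left, avg_const ha hb, ← hm]
    ring
  have h3 := avg_pow_freeCount_sq_le (n := n) ha hb hr hr1
  refine abs_le_of_sq_le_sq' ?_ (mul_nonneg (Real.sqrt_nonneg _) (by linarith)) |>.2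
  rw [mul_pow, Real.sq_sqrt n.cast_nonneg]
  linarith

end Concentration

/-! ### Generating function of the symbols on a diagonal -/

section Mark

variable {n k : ℕ} {a b : ℝ} {x y : ℂ}

/-- The contribution of a tableau to the generating function of its `k`-th diagonal. -/
noncomputable def mark (x y : ℂ) (k : ℕ) (S : StaircaseTableau n) : ℂ :=
  x ^ S.diagCount k .alpha * y ^ S.diagCount k .beta

/-- The contribution of the new column to the generating function. -/
noncomputable def colMark (x y : ℂ) (k : ℕ) (c : Fin (n + 1) → Option StSymbol) : ℂ :=
  x ^ (Finset.univ.filter fun i : Fin (n + 1) => (i : ℕ) + k = n + 1 ∧ c i = some .alpha).card *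
  y ^ (Finset.univ.filter fun i : Fin (n + 1) => (i : ℕ) + k = n + 1 ∧ c i = some .beta).card

lemma mark_cons (S : StaircaseTableau n) (c : S.Col) :
    (S.cons c).mark x y k = S.mark x y k * colMark x y k c.1 := by
  rw [mark, mark, colMark, diagCount_cons, diagCount_cons, pow_add, pow_add]
  ring

lemma norm_mark_le (hx : ‖x‖ ≤ 1) (hy : ‖y‖ ≤ 1) (S : StaircaseTableau n) :
    ‖S.mark x y k‖ ≤ 1 := by
  rw [mark, norm_mul, norm_pow, norm_pow]
  exact mul_le_one₀ (pow_le_one₀ (norm_nonneg _) hx) (by positivity)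
    (pow_le_one₀ (norm_nonneg _) hy)

lemma colMark_of_lt (h : n + 1 < k) (c : Fin (n + 1) → Option StSymbol) :
    colMark x y k c = 1 := by
  have : ∀ s, (Finset.univ.filter fun i : Fin (n + 1) => (i : ℕ) + k = n + 1 ∧ c i = some s) =
      ∅ := fun s => Finset.filter_eq_empty_iff.2 fun i _ hi => by omega
  simp [colMark, this]

open Classical in
-- A column meets the diagonal in a single box. The contribution `1`, `x` or `y` is written through
-- the two indicators whose column averages are explicit.
lemma colMark_eq (h : Fin n) (hk : h + k = n + 1) (c : Fin (n + 1) → Option StSymbol) :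
    colMark x y k c = 1 + (x - y) * (if c h.castSucc = some .alpha then 1 else 0) +
      (y - 1) * (if c h.castSucc ≠ none then 1 else 0) := by
  have : ∀ s, (Finset.univ.filter fun i : Fin (n + 1) =>
      (i : ℕ) + k = n + 1 ∧ c i = some s).card = if c h.castSucc = some s then 1 else 0 := by
    intro s
    have h1 : (Finset.univ.filter fun i : Fin (n + 1) => (i : ℕ) + k = n + 1 ∧ c i = some s) =
        Finset.univ.filter fun i : Fin (n + 1) => i = h.castSucc ∧ c h.castSucc = some s := by
      ext i
      simp only [Finset.mem_filter, Finset.mem_univ, true_and]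
      have h2 : (i : ℕ) + k = n + 1 ↔ i = h.castSucc := by
        rw [Fin.ext_iff, Fin.val_castSucc]; omega
      rw [h2]
      exact and_congr_right fun h3 => by rw [h3]
    rw [h1]
    split_ifs with h2 <;> simp [h2, Finset.filter_eq']
  rw [colMark, this, this]
  rcases c h.castSucc with _ | _ | _ <;> simp
  ring

lemma norm_colMark_sub_one_le (hx : ‖x‖ ≤ 1) (hy : ‖y‖ ≤ 1) (c : Fin (n + 1) → Option StSymbol) :
    ‖colMark x y k c - 1‖ ≤ 2 := by
  have : ‖colMark x y k c‖ ≤ 1 := by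
    rw [colMark, norm_mul, norm_pow, norm_pow]
    exact mul_le_one₀ (pow_le_one₀ (norm_nonneg _) hx) (by positivity)
      (pow_le_one₀ (norm_nonneg _) hy)
  calc _ ≤ ‖colMark x y k c‖ + ‖(1 : ℂ)‖ := norm_sub_le _ _
    _ ≤ 2 := by rw [norm_one]; linarith

lemma colAvg_nonempty_le (ha : 0 < a) (hb : 0 < b) (S : StaircaseTableau n) (h : Fin n) :
    colAvg a b S (fun c => if c.1 h.castSucc ≠ none then (1 : ℝ) else 0) ≤ 1 / (b + 1) := by
  classical
  have := colAvg_nonempty ha hb S h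
  have h0 : (0 : ℝ) ≤ 1 / (b + 1) := by positivity
  convert this.trans_le (by split_ifs; exacts [le_rfl, h0] : _ ≤ 1 / (b + 1))

/-- The average of `g` against the generating function of the `k`-th diagonal. -/
noncomputable def markAvg (x y : ℂ) (k : ℕ) (a b : ℝ) (g : StaircaseTableau n → ℝ) : ℂ :=
  avg a b fun S => S.mark x y k * (g S : ℂ)

lemma norm_markAvg_le (ha : 0 < a) (hb : 0 < b) (hx : ‖x‖ ≤ 1) (hy : ‖y‖ ≤ 1)
    (g : StaircaseTableau n → ℝ) : ‖markAvg x y k a b g‖ ≤ avg a b fun S => |g S| := by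
  refine (norm_avg_le ha hb _).trans (avg_mono ha hb fun S => ?_)
  rw [norm_mul, Complex.norm_real, Real.norm_eq_abs]
  exact mul_le_of_le_one_left (abs_nonneg _) (norm_mark_le hx hy S)

lemma markAvg_add (g g' : StaircaseTableau n → ℝ) :
    markAvg x y k a b (fun S => g S + g' S) = markAvg x y k a b g + markAvg x y k a b g' := by
  simp only [markAvg, Complex.ofReal_add, mul_add, avg_add]

lemma markAvg_succ (hb : 0 < b) (g : StaircaseTableau (n + 1) → ℝ) :
    markAvg x y k a b g = avg a (b + 1) fun S => S.mark x y k *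
      colAvg a b S fun c => colMark x y k c.1 * (g (S.cons c) : ℂ) := by
  rw [markAvg, avg_succ hb]
  simp only [mark_cons, mul_assoc, colAvg_mul_left]

/-- Decoupling of one column: its mark differs from `1` by at most `2`, and only when its diagonal
box is filled, which has probability at most `1 / (b + 1)`. Replacing the mark by `1` leaves the
column average of `g'`, which is `g` up to `e`. -/
lemma norm_markAvg_succ_sub_le (ha : 0 < a) (hb : 0 < b) (hx : ‖x‖ ≤ 1) (hy : ‖y‖ ≤ 1)
    (hk : 1 < k) {g' : StaircaseTableau (n + 1) → ℝ} {g : StaircaseTableau n → ℝ} {e G : ℝ}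
    (hG0 : 0 ≤ G) (hG : ∀ S, |g' S| ≤ G)
    (he : ∀ S, |colAvg a b S (fun c => g' (S.cons c)) - g S| ≤ e) :
    ‖markAvg x y k a b g' - markAvg x y k a (b + 1) g‖ ≤ e + 2 * G / (b + 1) := by
  classical
  have hb1 : 0 < b + 1 := by positivity
  rw [markAvg_succ hb, markAvg, ← avg_sub]
  refine (norm_avg_le ha hb1 _).trans ?_
  rw [← avg_const (n := n) ha hb1 (e + 2 * G / (b + 1))]
  refine avg_mono ha hb1 fun S => ?_
  rw [← mul_sub, norm_mul]
  refine (mul_le_of_le_one_left (norm_nonneg _) (norm_mark_le hx hy S)).trans ?_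
  have h1 : colAvg a b S (fun c => colMark x y k c.1 * (g' (S.cons c) : ℂ)) - (g S : ℂ) =
      colAvg a b S (fun c => (colMark x y k c.1 - 1) * (g' (S.cons c) : ℂ)) +
        ((colAvg a b S (fun c => g' (S.cons c)) - g S : ℝ) : ℂ) := by
    simp only [sub_mul, one_mul, colAvg_sub, colAvg_ofReal]
    push_cast
    ring
  rw [h1, add_comm]
  refine (norm_add_le _ _).trans (add_le_add ?_ ?_)
  · rw [Complex.norm_real]
    exact he S
  refine (norm_colAvg_le ha hb S _).trans ?_
  by_cases hkn : n + 1 < k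
  · simp only [colMark_of_lt hkn, sub_self, zero_mul, norm_zero, colAvg_const ha hb]
    positivity
  -- Since `1 < k`, the diagonal box lies strictly above the bottom box, which is always filled.
  obtain ⟨h, hh⟩ : ∃ h : Fin n, h + k = n + 1 := ⟨⟨n + 1 - k, by omega⟩, by simp; omega⟩
  calc _ ≤ colAvg a b S fun c => (2 * G) * if c.1 h.castSucc ≠ none then (1 : ℝ) else 0 := by
        refine colAvg_mono ha hb S fun c => ?_
        rw [norm_mul, Complex.norm_real]
        split_ifs with hc
        · rw [mul_one]
          exact mul_le_mul (norm_colMark_sub_one_le hx hy _) (hG _) (norm_nonneg _) (by simp)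
        · have hc' : c.1 h.castSucc = none := by simpa using hc
          rw [colMark_eq h hh]
          simp [hc']
    _ ≤ (2 * G) * (1 / (b + 1)) := by
        rw [colAvg_mul_left]
        exact mul_le_mul_of_nonneg_left (colAvg_nonempty_le ha hb S h) (by positivity)
    _ = _ := by ring

end Mark

end StaircaseTableau

/-! ### Decoupling a row from the diagonal across several columns -/

namespace StaircaseTableau

section Lag

variable {n k : ℕ} {a b : ℝ} {x y : ℂ}

/-- Telescoping of the one-column decoupling along an approximate martingale `g`. The parameter `C -
τ` at size `τ` is the one produced by `avg_succ`. -/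
lemma norm_markAvg_sub_le_of_steps (ha : 0 < a) (hx : ‖x‖ ≤ 1) (hy : ‖y‖ ≤ 1) (hk : 1 < k)
    (g : ∀ τ, StaircaseTableau τ → ℝ) {C J e G : ℝ} (hJ : 0 < J) (hG0 : 0 ≤ G) (s m : ℕ)
    (hC : J ≤ C - (s + m : ℕ))
    (hG : ∀ τ, s < τ → τ ≤ s + m → ∀ S, |g τ S| ≤ G)
    (he : ∀ τ, s ≤ τ → τ < s + m → ∀ S : StaircaseTableau τ,
      |colAvg a (C - (τ + 1 : ℕ)) S (fun c => g (τ + 1) (S.cons c)) - g τ S| ≤ e) :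
    ‖markAvg x y k a (C - (s + m : ℕ)) (g (s + m)) - markAvg x y k a (C - s) (g s)‖ ≤
      m * (e + 2 * G / J) := by
  induction m with
  | zero => simp
  | succ m ih =>
    have hC' : J ≤ C - (s + m + 1 : ℕ) := hC
    push_cast at hC'
    have h1 := ih (by push_cast; linarith) (fun τ h1 h2 => hG τ h1 (by omega))
      (fun τ h1 h2 => he τ h1 (by omega))
    have hb : 0 < C - (s + m + 1 : ℕ) := hJ.trans_le hC
    have h2 := norm_markAvg_succ_sub_le (n := s + m) (x := x) (y := y) (k := k) ha hb hx hy hk hG0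
      (hG (s + m + 1) (by omega) le_rfl) (he (s + m) (by omega) (by omega))
    have h3 : C - (s + m + 1 : ℕ) + 1 = C - (s + m : ℕ) := by push_cast; ring
    rw [h3] at h2
    have h4 : 2 * G / (C - (s + m : ℕ)) ≤ 2 * G / J :=
      div_le_div_of_nonneg_left (by positivity) hJ (by push_cast; linarith)
    calc _ ≤ _ := norm_sub_le_norm_sub_add_norm_sub _
          (markAvg x y k a (C - (s + m : ℕ)) (g (s + m))) _
      _ ≤ (e + 2 * G / (C - (s + m : ℕ))) + m * (e + 2 * G / J) := add_le_add h2 h1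
      _ ≤ (e + 2 * G / J) + m * (e + 2 * G / J) := by linarith
      _ = _ := by push_cast; ring

/-- The indicator of the event that the row `s` exists and is free. -/
noncomputable def freeInd (s : ℕ) (S : StaircaseTableau n) : ℝ := by
  classical exact if ∃ h : s < n, S.freeRow ⟨s, h⟩ then 1 else 0

lemma freeInd_nonneg (s : ℕ) (S : StaircaseTableau n) : 0 ≤ S.freeInd s := by
  rw [freeInd]; split_ifs <;> simp

lemma freeInd_le_one (s : ℕ) (S : StaircaseTableau n) : S.freeInd s ≤ 1 := by
  rw [freeInd]; split_ifs <;> simp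

open Classical in
lemma freeInd_eq (h : Fin n) (S : StaircaseTableau n) :
    S.freeInd h = if S.freeRow h then 1 else 0 := by
  simp [freeInd]

open Classical in
lemma freeInd_cons (h : Fin n) (S : StaircaseTableau n) (c : S.Col) :
    (S.cons c).freeInd h =
      S.freeInd h * (1 - if c.1 h.castSucc = some .beta then 1 else 0) := by
  rw [freeInd_eq, ← Fin.val_castSucc h, freeInd_eq, freeRow_cons, availRow_castSucc]
  by_cases h1 : S.freeRow h <;> by_cases h2 : c.1 h.castSucc = some .beta <;> simp [h1, h2]

open Classical in
lemma freeInd_cons_last (S : StaircaseTableau n) (c : S.Col) :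
    (S.cons c).freeInd n = if c.1 (Fin.last n) = some .alpha then 1 else 0 := by
  have := freeInd_eq (Fin.last n) (S.cons c)
  rw [Fin.val_last] at this
  rw [this, freeRow_cons]
  have h := c.2.bottom
  rcases hc : c.1 (Fin.last n) with _ | _ | _
  · exact absurd hc h
  all_goals simp [availRow_last]

/-- A free row ceases to be free only if its box in the new column is filled, an event of
probability at most `1 / (b + 1)`. -/
lemma abs_colAvg_freeInd_sub_le (ha : 0 < a) (hb : 0 < b) (h : Fin n) (S : StaircaseTableau n)
    {v : StaircaseTableau (n + 1) → ℝ} {G : ℝ} (hv0 : ∀ S, 0 ≤ v S) (hv : ∀ S, v S ≤ G) :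
    |colAvg a b S (fun c => (S.cons c).freeInd h * v (S.cons c)) -
      S.freeInd h * colAvg a b S (fun c => v (S.cons c))| ≤ G / (b + 1) := by
  classical
  rw [← colAvg_mul_left, ← colAvg_sub]
  refine (norm_colAvg_le (E := ℝ) ha hb S _).trans ?_
  have hG : 0 ≤ G := by
    have := colAvg_mono ha hb S fun c => (hv0 (S.cons c)).trans (hv _)
    rwa [colAvg_const ha hb S (0 : ℝ), colAvg_const ha hb S G] at this
  calc _ ≤ colAvg a b S fun c => G * if c.1 h.castSucc ≠ none then (1 : ℝ) else 0 := by
        refine colAvg_mono ha hb S fun c => ?_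
        rw [freeInd_cons, Real.norm_eq_abs]
        have h0 := freeInd_nonneg h S
        have h1 := freeInd_le_one h S
        rcases c.1 h.castSucc with _ | _ | _ <;> simp
        · exact hG
        · rw [abs_of_nonneg h0, abs_of_nonneg (hv0 _)]
          exact (mul_le_mul h1 (hv _) (hv0 _) zero_le_one).trans_eq (one_mul _)
    _ ≤ G * (1 / (b + 1)) := by
        rw [colAvg_mul_left]
        exact mul_le_mul_of_nonneg_left (colAvg_nonempty_le ha hb S h) hG
    _ = _ := by ring

/-- The new bottom row is free exactly when its box holds α; this empties the rest of the column, so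
the average depends on `S` only through `freeCount`. -/
lemma colAvg_freeInd_last (S : StaircaseTableau n) (v r : ℝ) :
    colAvg a b S (fun c => (S.cons c).freeInd n * (v * r ^ (S.cons c).freeCount)) =
      v * (b * r) / (a + b) * (b * r / (b + 1)) ^ S.freeCount := by
  classical
  have h : ∀ c : S.Col, (S.cons c).freeInd n * (v * r ^ (S.cons c).freeCount) =
      v * if c.1 (Fin.last n) = some .alpha then r ^ (S.cons c).freeCount else 0 := fun c => by
    rw [freeInd_cons_last]
    split_ifs <;> ring
  simp only [h]
  rw [colAvg_mul_left, colAvg_bottom_alpha_mul_pow, div_pow, ← div_div]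
  ring

/-- By `hmart` the factor `κ τ * ρ τ ^ freeCount` is a martingale, so stripping each of the `m`
columns added after row `s` was created costs only decoupling errors of order `1 / J`. The column
creating row `s` is then averaged exactly, which leaves a function of `freeCount` alone; `p` is the
intended mean. -/
lemma norm_markAvg_free_le (ha : 0 < a) (hx : ‖x‖ ≤ 1) (hy : ‖y‖ ≤ 1) (hk : 1 < k)
    {κ ρ : ℕ → ℝ} {C J G p : ℝ} (hJ : 0 < J) (hp : 0 ≤ p) (s m : ℕ)
    (hC : J ≤ C - (s + 1 + m : ℕ))
    (hκ0 : ∀ τ, s < τ → τ ≤ s + 1 + m → 0 ≤ κ τ) (hκ : ∀ τ, s < τ → τ ≤ s + 1 + m → κ τ ≤ G)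
    (hρ0 : ∀ τ, s < τ → τ ≤ s + 1 + m → 0 ≤ ρ τ) (hρ : ∀ τ, s < τ → τ ≤ s + 1 + m → ρ τ ≤ 1)
    (hmart : ∀ τ, s < τ → τ < s + 1 + m → ∀ S : StaircaseTableau τ,
      colAvg a (C - (τ + 1 : ℕ)) S (fun c => κ (τ + 1) * ρ (τ + 1) ^ (S.cons c).freeCount) =
        κ τ * ρ τ ^ S.freeCount) :
    ‖markAvg x y k a (C - (s + 1 + m : ℕ)) (fun S : StaircaseTableau (s + 1 + m) =>
        S.freeInd s * (κ (s + 1 + m) * ρ (s + 1 + m) ^ S.freeCount) - p)‖ ≤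
      m * (G / J + 2 * (G + p) / J) + 2 * (G + p) / J +
      ‖markAvg x y k a (C - s) (fun S : StaircaseTableau s =>
        κ (s + 1) * ((C - (s + 1 : ℕ)) * ρ (s + 1)) / (a + (C - (s + 1 : ℕ))) *
          ((C - (s + 1 : ℕ)) * ρ (s + 1) / (C - s)) ^ S.freeCount - p)‖ := by
  have hG0 : 0 ≤ G := (hκ0 (s + 1) (by omega) (by omega)).trans (hκ _ (by omega) (by omega))
  have hv0 : ∀ τ, s < τ → τ ≤ s + 1 + m → ∀ S : StaircaseTableau τ,
      0 ≤ κ τ * ρ τ ^ S.freeCount := fun τ h1 h2 S =>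
    mul_nonneg (hκ0 τ h1 h2) (pow_nonneg (hρ0 τ h1 h2) _)
  have hv : ∀ τ, s < τ → τ ≤ s + 1 + m → ∀ S : StaircaseTableau τ,
      κ τ * ρ τ ^ S.freeCount ≤ G := fun τ h1 h2 S =>
    (mul_le_of_le_one_right (hκ0 τ h1 h2) (pow_le_one₀ (hρ0 τ h1 h2) (hρ τ h1 h2))).trans
      (hκ τ h1 h2)
  have hC' := hC
  push_cast at hC'
  have hm0 : (0 : ℝ) ≤ m := m.cast_nonneg
  set g : ∀ τ, StaircaseTableau τ → ℝ := fun τ S =>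
    S.freeInd s * (κ τ * ρ τ ^ S.freeCount) - p with hg
  have hgG : ∀ τ, s < τ → τ ≤ s + 1 + m → ∀ S, |g τ S| ≤ G + p := by
    intro τ h1 h2 S
    have h3 := freeInd_nonneg s S
    have h4 := freeInd_le_one s S
    have h5 := mul_nonneg h3 (hv0 τ h1 h2 S)
    have h6 := (mul_le_of_le_one_left (hv0 τ h1 h2 S) h4).trans (hv τ h1 h2 S)
    rw [abs_le]
    constructor <;> simp only [hg] <;> linarith
  have h1 := norm_markAvg_sub_le_of_steps (x := x) (y := y) (k := k) (C := C) (e := G / J) ha hx hy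
    hk g hJ (add_nonneg hG0 hp) (s + 1) m hC (fun τ h1 h2 => hgG τ (by omega) h2) (by
      intro τ hτ1 hτ2 S
      have hτ3 : ((τ + 1 : ℕ) : ℝ) ≤ (s + 1 + m : ℕ) := by exact_mod_cast hτ2
      have hb : J ≤ C - (τ + 1 : ℕ) := by linarith
      have h2 := abs_colAvg_freeInd_sub_le (v := fun S => κ (τ + 1) * ρ (τ + 1) ^ S.freeCount)
        ha (hJ.trans_le hb) ⟨s, hτ1⟩ S (hv0 (τ + 1) (by omega) (by omega))
        (hv (τ + 1) (by omega) (by omega))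
      rw [hmart τ (by omega) hτ2 S] at h2
      simp only [hg]
      rw [colAvg_sub, colAvg_const ha (hJ.trans_le hb), sub_sub_sub_cancel_right]
      refine h2.trans (div_le_div_of_nonneg_left hG0 hJ (by linarith)))
  have hb : J ≤ C - (s + 1 : ℕ) := by push_cast; linarith
  have h2 := norm_markAvg_succ_sub_le (x := x) (y := y) (k := k) (e := 0) ha (hJ.trans_le hb) hx hy
    hk (add_nonneg hG0 hp) (hgG (s + 1) (by omega) (by omega))
    (g := fun S : StaircaseTableau s =>
        κ (s + 1) * ((C - (s + 1 : ℕ)) * ρ (s + 1)) / (a + (C - (s + 1 : ℕ))) *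
          ((C - (s + 1 : ℕ)) * ρ (s + 1) / (C - s)) ^ S.freeCount - p) (by
      intro S
      simp only [hg]
      rw [colAvg_sub, colAvg_const ha (hJ.trans_le hb), colAvg_freeInd_last]
      have : C - (s + 1 : ℕ) + 1 = C - s := by push_cast; ring
      rw [this]
      simp)
  have h3 : C - (s + 1 : ℕ) + 1 = C - s := by push_cast; ring
  rw [h3, zero_add] at h2
  have h4 : 2 * (G + p) / (C - s) ≤ 2 * (G + p) / J :=
    div_le_div_of_nonneg_left (by positivity) hJ (by linarith)
  have h5 := norm_le_norm_sub_add (markAvg x y k a (C - (s + 1 + m : ℕ)) (g (s + 1 + m)))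
    (markAvg x y k a (C - (s + 1 : ℕ)) (g (s + 1)))
  have h6 := norm_le_norm_sub_add (markAvg x y k a (C - (s + 1 : ℕ)) (g (s + 1)))
    (markAvg x y k a (C - s) (fun S : StaircaseTableau s =>
        κ (s + 1) * ((C - (s + 1 : ℕ)) * ρ (s + 1)) / (a + (C - (s + 1 : ℕ))) *
          ((C - (s + 1 : ℕ)) * ρ (s + 1) / (C - s)) ^ S.freeCount - p))
  linarith

/-- The first term is the fluctuation of `r ^ freeCount`, the second the bias of its mean; the mark
only enters through its norm, at most `1`. -/
lemma norm_markAvg_pow_sub_le (ha : 0 < a) (hb : 0 < b) (hx : ‖x‖ ≤ 1) (hy : ‖y‖ ≤ 1)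
    {r A p : ℝ} (hA : 0 ≤ A) (hr : 0 ≤ r) (hr1 : r ≤ 1) :
    ‖markAvg x y k a b (fun S : StaircaseTableau n => A * r ^ S.freeCount - p)‖ ≤
      A * (√n * (1 - r)) +
        |A * avg a b (fun S : StaircaseTableau n => r ^ S.freeCount) - p| := by
  set M := avg a b (fun S : StaircaseTableau n => r ^ S.freeCount) with hM
  refine (norm_markAvg_le ha hb hx hy _).trans ?_
  calc _ ≤ avg a b fun S : StaircaseTableau n => A * |r ^ S.freeCount - M| + |A * M - p| := by
        refine avg_mono ha hb fun S => ?_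
        have : A * r ^ S.freeCount - p = A * (r ^ S.freeCount - M) + (A * M - p) := by ring
        rw [this]
        refine (abs_add_le _ _).trans_eq ?_
        rw [abs_mul, abs_of_nonneg hA]
    _ ≤ _ := by
        rw [avg_add, avg_mul_left, avg_const ha hb]
        gcongr
        exact avg_abs_pow_sub_le ha hb hr hr1

lemma dualPartition_mul_add (n : ℕ) (a b : ℝ) :
    dualPartition n a b * (a + b + n) = (a + b) * dualPartition n a (b + 1) := by
  rw [← dualPartition_succ, dualPartition, dualPartition, Finset.prod_range_succ]

/-- For this base the mean is a quotient of partition functions with second parameters `b` and `b +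
1`, which telescopes to one factor. -/
lemma avg_pow_freeCount_one_step (ha : 0 < a) (hb : 0 < b) :
    avg a (b + 1) (fun S : StaircaseTableau n => (b / (b + 1)) ^ S.freeCount) =
      (a + b) / (a + b + n) := by
  rw [avg_pow_freeCount, mul_div_cancel₀ _ (by positivity),
    div_eq_div_iff (dualPartition_pos ha (by positivity)).ne' (by positivity),
    dualPartition_mul_add]

lemma avg_pow_freeCount_two_step (ha : 0 < a) (hb : 0 < b) :
    avg a (b + 2) (fun S : StaircaseTableau n => (b / (b + 2)) ^ S.freeCount) =
      (a + b) * (a + b + 1) / ((a + b + n) * (a + b + n + 1)) := by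
  have h1 := dualPartition_mul_add n a b
  have h2 := dualPartition_mul_add n a (b + 1)
  rw [show b + 1 + 1 = b + 2 by ring] at h2
  rw [avg_pow_freeCount, mul_div_cancel₀ _ (by positivity),
    div_eq_div_iff (dualPartition_pos ha (by positivity)).ne' (by positivity)]
  linear_combination (a + b + n + 1) * h1 + (a + b) * h2

end Lag

end StaircaseTableau

/-! ### The diagonal box of one new column -/

namespace StaircaseTableau

section OneColumn

variable {n k : ℕ} {a b : ℝ} {x y : ℂ}

lemma freeAbove_le_freeCount (S : StaircaseTableau n) (h : Fin n) :
    S.freeAbove h ≤ S.freeCount := by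
  classical
  exact Finset.card_le_card fun i hi => by simp at hi ⊢; exact hi.2

lemma freeCount_le_freeAbove_add (S : StaircaseTableau n) (h : Fin n) :
    S.freeCount ≤ S.freeAbove h + (n - 1 - h) := by
  classical
  rw [← Fin.card_Ioi]
  refine le_trans (Finset.card_le_card fun i hi => ?_) (Finset.card_union_le _ _)
  simp only [Finset.mem_filter, Finset.mem_univ, true_and, Finset.mem_union, Finset.mem_Ioi] at hi ⊢
  rcases le_or_gt i h with h1 | h1
  exacts [Or.inl ⟨h1, hi⟩, Or.inr h1]

/-- Only `m` rows lie below `h`, so the exponents differ by at most `m`; Bernoulli's inequality does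
the rest. -/
lemma abs_pow_freeAbove_sub_le {r : ℝ} (hr : 0 ≤ r) (hr1 : r ≤ 1) (S : StaircaseTableau n)
    (h : Fin n) {m : ℕ} (hm : n = h + 1 + m) :
    |r ^ S.freeAbove h - r ^ S.freeCount| ≤ m * (1 - r) := by
  have h1 := S.freeAbove_le_freeCount h
  have h2 : S.freeCount ≤ S.freeAbove h + m :=
    (S.freeCount_le_freeAbove_add h).trans (by omega)
  rw [abs_of_nonneg (sub_nonneg.2 (pow_le_pow_of_le_one hr hr1 h1))]
  have h3 : r ^ (S.freeAbove h + m) ≤ r ^ S.freeCount := pow_le_pow_of_le_one hr hr1 h2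
  have h4 : 1 + m * (r - 1) ≤ (1 + (r - 1)) ^ m := one_add_mul_le_pow (by linarith) m
  rw [add_sub_cancel] at h4
  have h5 : r ^ S.freeAbove h ≤ 1 := pow_le_one₀ hr hr1
  have h6 : 0 ≤ r ^ S.freeAbove h := pow_nonneg hr _
  have h7 : r ^ m ≤ 1 := pow_le_one₀ hr hr1
  rw [pow_add] at h3
  nlinarith

/-- The main estimate for the occurrence of `α` in the box of row `s` in a new column. -/
lemma norm_markAvg_alpha_le (ha : 0 < a) (hx : ‖x‖ ≤ 1) (hy : ‖y‖ ≤ 1) (hk : 1 < k)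
    {C J p : ℝ} (hJ : 0 < J) (hp : 0 ≤ p) (hpJ : p ≤ 1 / J) (s m : ℕ)
    (hC : J ≤ C - (s + 1 + m + 1)) :
    ‖markAvg x y k a (C - (s + 1 + m : ℕ)) (fun S : StaircaseTableau (s + 1 + m) =>
        S.freeInd s * (((C - (s + 1 + m + 1)) / (C - (s + 1 + m))) ^
          S.freeAbove ⟨s, by omega⟩ / (a + (C - (s + 1 + m + 1)))) - p)‖ ≤
      (6 * m + 4 + 2 * √s) / J ^ 2 + |(C - s - 2) / ((a + C - 1) * (a + C - 2)) - p| := by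
  have hm0 : (0 : ℝ) ≤ m := m.cast_nonneg
  have hs0 : (0 : ℝ) ≤ s := s.cast_nonneg
  -- At size `s + 1 + m` this choice gives the probability of α in a free row with `freeAbove`
  -- replaced by `freeCount`; by `colAvg_pow_freeCount` it propagates backwards as an exact
  -- martingale.
  set κ : ℕ → ℝ := fun τ => 1 / (a + (C - (τ + 1)))
  set ρ : ℕ → ℝ := fun τ => (C - (τ + 1)) / (C - τ)
  have hτ : ∀ τ : ℕ, τ ≤ s + 1 + m → J ≤ C - (τ + 1) := fun τ h => by
    have : (τ : ℝ) ≤ s + 1 + m := by exact_mod_cast h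
    linarith
  have h1 := norm_markAvg_free_le (κ := κ) (ρ := ρ) (C := C) (G := 1 / J) ha hx hy hk hJ hp s m
    (by have := hτ _ le_rfl; push_cast at this ⊢; linarith)
    (fun τ _ h2 => by have := hτ τ h2; exact one_div_nonneg.2 (by linarith))
    (fun τ _ h2 => by
      have := hτ τ h2
      exact one_div_le_one_div_of_le hJ (by linarith))
    (fun τ _ h2 => by
      have := hτ τ h2
      exact div_nonneg (by linarith) (by linarith))
    (fun τ _ h2 => by
      have := hτ τ h2
      exact div_le_one_of_le₀ (by linarith) (by linarith))
    (fun τ _ h2 S => by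
      have h3 := hτ (τ + 1) h2
      push_cast at h3
      rw [colAvg_mul_left, colAvg_pow_freeCount]
      have e1 : (C - ((τ + 1 : ℕ) : ℝ)) * ρ (τ + 1) = C - (τ + 2) := by
        simp only [ρ]
        push_cast
        rw [mul_div_cancel₀ _ (by linarith : C - ((τ : ℝ) + 1) ≠ 0)]
        ring
      rw [e1]
      simp only [κ, ρ]
      push_cast
      have h4 : a + (C - ((τ : ℝ) + 1 + 1)) ≠ 0 := by linarith
      have h5 : a + (C - ((τ : ℝ) + 1)) ≠ 0 := by linarith
      have h6 : C - (τ : ℝ) ≠ 0 := by linarith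
      rw [show C - ((τ : ℝ) + 2) + 1 = C - (τ + 1) by ring,
        show C - ((τ : ℝ) + 1) + 1 = C - τ by ring,
        show a + (C - ((τ : ℝ) + 2)) = a + (C - ((τ : ℝ) + 1 + 1)) by ring, div_pow]
      field_simp)
  have hB := hτ (s + 1) (by omega)
  push_cast at hB
  have e1 : (C - ((s + 1 : ℕ) : ℝ)) * ρ (s + 1) = C - s - 2 := by
    simp only [ρ]
    push_cast
    rw [mul_div_cancel₀ _ (by linarith : C - ((s : ℝ) + 1) ≠ 0)]
    ring
  rw [e1] at h1
  have hb : 0 < C - s - 2 := by linarith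
  set A := κ (s + 1) * (C - s - 2) / (a + (C - (s + 1 : ℕ))) with hA
  have hA' : A = (C - s - 2) / ((a + (C - s - 2)) * (a + (C - s - 2) + 1)) := by
    simp only [hA, κ]
    push_cast
    have h4 : a + (C - ((s : ℝ) + 1 + 1)) ≠ 0 := by linarith
    have h5 : a + (C - ((s : ℝ) + 1)) ≠ 0 := by linarith
    rw [show a + (C - ((s : ℝ) + 1)) = a + (C - s - 2) + 1 by ring,
      show a + (C - ((s : ℝ) + 1 + 1)) = a + (C - s - 2) by ring]
    rw [one_div_mul_eq_div, div_div]
  have hA0 : 0 ≤ A := by rw [hA']; positivity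
  have hA1 : A ≤ 1 / J := by
    rw [hA', div_mul_eq_div_div]
    refine div_le_div₀ zero_le_one (div_le_one_of_le₀ (by linarith) (by positivity)) hJ
      (by linarith)
  have h2 := norm_markAvg_pow_sub_le (n := s) (k := k) (r := (C - s - 2) / (C - s)) (p := p) ha
    (show 0 < C - s by linarith) hx hy hA0 (div_nonneg hb.le (by linarith))
    (div_le_one_of_le₀ (by linarith) (by linarith))
  -- The base `(C - s - 2) / (C - s)` combines the martingale factor with the creation of row `s`,
  -- hence a shift by two.
  have h3 := avg_pow_freeCount_two_step (n := s) ha hb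
  rw [show C - s - 2 + 2 = C - s by ring] at h3
  rw [h3] at h2
  have h4 : A * ((a + (C - s - 2)) * (a + (C - s - 2) + 1) /
      ((a + (C - s - 2) + s) * (a + (C - s - 2) + s + 1))) =
      (C - s - 2) / ((a + C - 1) * (a + C - 2)) := by
    rw [hA', show a + (C - s - 2) + s + 1 = a + C - 1 by ring,
      show a + (C - s - 2) + s = a + C - 2 by ring]
    rw [div_mul_div_cancel₀ (by positivity), mul_comm (a + C - 2)]
  rw [h4] at h2
  have h5 : A * (√s * (1 - (C - s - 2) / (C - s))) ≤ 2 * √s / J ^ 2 := by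
    have h6 : 1 - (C - s - 2) / (C - s) ≤ 2 / J := by
      rw [one_sub_div (by linarith)]
      exact div_le_div₀ (by norm_num) (by linarith) hJ (by linarith)
    calc _ ≤ 1 / J * (√s * (2 / J)) := by
          gcongr
          exact mul_nonneg (Real.sqrt_nonneg _)
            (sub_nonneg.2 (div_le_one_of_le₀ (by linarith) (by linarith)))
      _ = _ := by ring
  have h6 := h1.trans (add_le_add le_rfl h2)
  have h7 := hτ _ le_rfl
  push_cast at h7
  -- The cost of replacing `freeAbove` by `freeCount`: `m * (1 / J)` for the power, times a
  -- prefactor of at most `1 / J`.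
  have h8 : ‖markAvg x y k a (C - (s + 1 + m : ℕ)) (fun S : StaircaseTableau (s + 1 + m) =>
      S.freeInd s * (((C - (s + 1 + m + 1)) / (C - (s + 1 + m))) ^
          S.freeAbove ⟨s, by omega⟩ / (a + (C - (s + 1 + m + 1)))) -
        S.freeInd s * (κ (s + 1 + m) * ρ (s + 1 + m) ^ S.freeCount))‖ ≤ m / J ^ 2 := by
    have hb' : 0 < C - (s + 1 + m : ℕ) := by push_cast; linarith
    refine (norm_markAvg_le ha hb' hx hy _).trans ?_
    rw [← avg_const (n := s + 1 + m) ha hb' ((m : ℝ) / J ^ 2)]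
    refine avg_mono ha hb' fun S => ?_
    have hr0 : 0 ≤ (C - (s + 1 + m + 1)) / (C - (s + 1 + m)) :=
      div_nonneg (by linarith) (by linarith)
    have hr1 : (C - (s + 1 + m + 1)) / (C - (s + 1 + m)) ≤ 1 :=
      div_le_one_of_le₀ (by linarith) (by linarith)
    have h9 := abs_pow_freeAbove_sub_le hr0 hr1 S ⟨s, by omega⟩ (m := m) rfl
    have h10 : 1 - (C - (s + 1 + m + 1)) / (C - (s + 1 + m)) ≤ 1 / J := by
      rw [one_sub_div (by linarith)]
      exact div_le_div₀ (by norm_num) (by linarith) hJ (by linarith)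
    have h11 : 1 / (a + (C - (s + 1 + m + 1))) ≤ 1 / J :=
      one_div_le_one_div_of_le hJ (by linarith)
    have h12 : 0 < a + (C - (s + 1 + m + 1)) := by linarith
    simp only [κ, ρ]
    push_cast
    rw [← mul_sub, abs_mul, abs_of_nonneg (freeInd_nonneg s S)]
    refine (mul_le_of_le_one_left (abs_nonneg _) (freeInd_le_one s S)).trans ?_
    rw [one_div_mul_eq_div, ← sub_div, abs_div, abs_of_pos h12, div_eq_mul_one_div]
    calc _ ≤ (m * (1 / J)) * (1 / J) := by
          refine mul_le_mul (h9.trans (mul_le_mul_of_nonneg_left h10 hm0)) h11 (by positivity)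
            (by positivity)
      _ = _ := by ring
  have h9 : ∀ S : StaircaseTableau (s + 1 + m), S.freeInd s * (((C - (s + 1 + m + 1)) /
        (C - (s + 1 + m))) ^ S.freeAbove ⟨s, by omega⟩ / (a + (C - (s + 1 + m + 1)))) - p =
      (S.freeInd s * (((C - (s + 1 + m + 1)) / (C - (s + 1 + m))) ^
          S.freeAbove ⟨s, by omega⟩ / (a + (C - (s + 1 + m + 1)))) -
        S.freeInd s * (κ (s + 1 + m) * ρ (s + 1 + m) ^ S.freeCount)) +
      (S.freeInd s * (κ (s + 1 + m) * ρ (s + 1 + m) ^ S.freeCount) - p) := fun S => by ring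
  simp only [h9]
  rw [markAvg_add]
  refine (norm_add_le _ _).trans ((add_le_add h8 h6).trans ?_)
  have h10 : 2 * (1 / J + p) / J ≤ 4 / J ^ 2 := by
    calc _ ≤ 2 * (1 / J + 1 / J) / J := by gcongr
      _ = _ := by ring
  have h11 : (6 * m + 4 + 2 * √s) / J ^ 2 =
      m / J ^ 2 + (m * (1 / J / J + 4 / J ^ 2) + 4 / J ^ 2) + 2 * √s / J ^ 2 := by ring
  rw [h11]
  have h12 : (m : ℝ) * (1 / J / J + 2 * (1 / J + p) / J) ≤ m * (1 / J / J + 4 / J ^ 2) := by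
    gcongr
  linarith

/-- The main estimate for the occurrence of a symbol in the box of row `s` in a new column. -/
lemma norm_markAvg_nonempty_le (ha : 0 < a) (hx : ‖x‖ ≤ 1) (hy : ‖y‖ ≤ 1) (hk : 1 < k)
    {C J p : ℝ} (hJ : 0 < J) (hp : 0 ≤ p) (hpJ : p ≤ 1 / J) (s m : ℕ)
    (hC : J ≤ C - (s + 1 + m + 1)) :
    ‖markAvg x y k a (C - (s + 1 + m : ℕ)) (fun S : StaircaseTableau (s + 1 + m) =>
        S.freeInd s * (1 / (C - (s + 1 + m))) - p)‖ ≤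
      (5 * m + 4 + √s) / J ^ 2 + |(C - s - 1) / ((C - (s + 1 + m)) * (a + C - 1)) - p| := by
  have hm0 : (0 : ℝ) ≤ m := m.cast_nonneg
  have hs0 : (0 : ℝ) ≤ s := s.cast_nonneg
  have hκ : 1 / (C - (s + 1 + m)) ≤ 1 / J := one_div_le_one_div_of_le hJ (by linarith)
  have hκ0 : 0 < C - (s + 1 + m) := by linarith
  have hτ : ∀ τ : ℕ, τ ≤ s + 1 + m → J ≤ C - (τ + 1) := fun τ h => by
    have : (τ : ℝ) ≤ s + 1 + m := by exact_mod_cast h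
    linarith
  -- The filling probability of a free box does not involve `freeCount`, so a constant martingale
  -- suffices.
  have h1 := norm_markAvg_free_le (κ := fun _ => 1 / (C - (s + 1 + m))) (ρ := fun _ => 1) (C := C)
    (G := 1 / J) ha hx hy hk hJ hp s m (by push_cast; linarith)
    (fun τ _ h2 => by positivity) (fun τ _ h2 => hκ) (fun τ _ h2 => zero_le_one)
    (fun τ _ h2 => le_rfl) (fun τ _ h2 S => by
      have := hτ τ h2.le
      simp only [one_pow]
      exact colAvg_const ha (by push_cast; linarith) S _)
  simp only [one_pow, mul_one] at h1
  have hb : 0 < C - s - 1 := by linarith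
  rw [show C - ((s + 1 : ℕ) : ℝ) = C - s - 1 by push_cast; ring] at h1
  set A := 1 / (C - (s + 1 + m)) * (C - s - 1) / (a + (C - s - 1)) with hA
  have hA0 : 0 ≤ A := by positivity
  have hA1 : A ≤ 1 / J := by
    rw [hA, mul_div_assoc]
    exact (mul_le_of_le_one_right (by positivity)
      (div_le_one_of_le₀ (by linarith) (by positivity))).trans hκ
  have h2 := norm_markAvg_pow_sub_le (n := s) (k := k) (r := (C - s - 1) / (C - s)) (p := p) ha
    (show 0 < C - s by linarith) hx hy hA0 (div_nonneg hb.le (by linarith))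
    (div_le_one_of_le₀ (by linarith) (by linarith))
  have h3 := avg_pow_freeCount_one_step (n := s) ha hb
  rw [show C - s - 1 + 1 = C - s by ring] at h3
  rw [h3] at h2
  have h4 : A * ((a + (C - s - 1)) / (a + (C - s - 1) + s)) =
      (C - s - 1) / ((C - (s + 1 + m)) * (a + C - 1)) := by
    rw [hA, show a + (C - s - 1) + s = a + C - 1 by ring, div_mul_div_cancel₀ (by positivity),
      one_div_mul_eq_div, div_div]
  rw [h4] at h2
  have h5 : A * (√s * (1 - (C - s - 1) / (C - s))) ≤ √s / J ^ 2 := by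
    have h6 : 1 - (C - s - 1) / (C - s) ≤ 1 / J := by
      rw [one_sub_div (by linarith)]
      exact div_le_div₀ (by norm_num) (by linarith) hJ (by linarith)
    calc _ ≤ 1 / J * (√s * (1 / J)) := by
          gcongr
          exact mul_nonneg (Real.sqrt_nonneg _)
            (sub_nonneg.2 (div_le_one_of_le₀ (by linarith) (by linarith)))
      _ = _ := by ring
  have h10 : 2 * (1 / J + p) / J ≤ 4 / J ^ 2 := by
    calc _ ≤ 2 * (1 / J + 1 / J) / J := by gcongr
      _ = _ := by ring
  have h11 : (5 * m + 4 + √s) / J ^ 2 =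
      (m * (1 / J / J + 4 / J ^ 2) + 4 / J ^ 2) + √s / J ^ 2 := by ring
  rw [h11]
  have h12 : (m : ℝ) * (1 / J / J + 2 * (1 / J + p) / J) ≤ m * (1 / J / J + 4 / J ^ 2) := by
    gcongr
  refine h1.trans ?_
  linarith

/-- The exact recursion for the generating function: average `colMark_eq` over the new column. The
estimates of the two correction terms drive the rest of the proof. -/
lemma markAvg_one_succ (ha : 0 < a) (hb : 0 < b) (h : Fin n) (hk : h + k = n + 1) :
    markAvg x y k a b (fun _ : StaircaseTableau (n + 1) => 1) =
      markAvg x y k a (b + 1) (fun _ : StaircaseTableau n => 1) +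
      (x - y) * markAvg x y k a (b + 1) (fun S : StaircaseTableau n =>
        S.freeInd h * ((b / (b + 1)) ^ S.freeAbove h / (a + b))) +
      (y - 1) * markAvg x y k a (b + 1) (fun S : StaircaseTableau n =>
        S.freeInd h * (1 / (b + 1))) := by
  classical
  rw [markAvg_succ hb]
  simp only [markAvg, ← avg_mul_left, ← avg_add]
  congr 1
  funext S
  have h1 : colAvg a b S (fun c => colMark x y k c.1 * ((1 : ℝ) : ℂ)) =
      colAvg a b S (fun c => (1 : ℂ) +
        (x - y) * ((if c.1 h.castSucc = some .alpha then (1 : ℝ) else 0 : ℝ) : ℂ) +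
        (y - 1) * ((if c.1 h.castSucc ≠ none then (1 : ℝ) else 0 : ℝ) : ℂ)) := by
    congr 1
    funext c
    rw [colMark_eq h hk]
    split_ifs <;> simp
  rw [h1, colAvg_add, colAvg_add, colAvg_mul_left, colAvg_mul_left, colAvg_const ha hb,
    colAvg_ofReal, colAvg_ofReal, colAvg_alpha ha hb, colAvg_nonempty ha hb, freeInd_eq]
  split_ifs <;> push_cast <;> ring

lemma markAvg_one_succ_of_lt (ha : 0 < a) (hb : 0 < b) (hk : n + 1 < k) :
    markAvg x y k a b (fun _ : StaircaseTableau (n + 1) => 1) =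
      markAvg x y k a (b + 1) (fun _ : StaircaseTableau n => 1) := by
  rw [markAvg_succ hb]
  simp only [colMark_of_lt hk, colAvg_const ha hb, one_mul, markAvg]

end OneColumn

end StaircaseTableau

/-! ### Crude and sharp one-column estimates for the generating function -/

namespace StaircaseTableau

section AllColumns

variable {n k : ℕ} {a b : ℝ} {x y : ℂ}

lemma avg_freeInd_succ_le (ha : 0 < a) (hb : 0 < b) (h : Fin n) :
    avg a b (fun S : StaircaseTableau (n + 1) => S.freeInd h) ≤
      avg a (b + 1) (fun S : StaircaseTableau n => S.freeInd h) := by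
  classical
  rw [avg_succ hb]
  refine avg_mono ha (by positivity) fun S => ?_
  rw [← colAvg_const ha hb S (S.freeInd h)]
  refine colAvg_mono ha hb S fun c => ?_
  rw [freeInd_cons]
  refine mul_le_of_le_one_right (freeInd_nonneg _ S) ?_
  split_ifs <;> simp

/-- The right-hand side is the exact probability that row `s` is free when created; later columns
can only decrease it. -/
lemma avg_freeInd_le (ha : 0 < a) (s m : ℕ) {C : ℝ} (hC : 0 < C - (s + 1 + m)) :
    avg a (C - (s + 1 + m)) (fun S : StaircaseTableau (s + 1 + m) => S.freeInd s) ≤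
      (C - s - 1) / (a + C - 1) := by
  induction m with
  | zero =>
    have h0 : C - (s + 1 + (0 : ℕ)) = C - s - 1 := by push_cast; ring
    rw [h0] at hC ⊢
    rw [avg_succ hC]
    have h1 : ∀ S : StaircaseTableau s,
        colAvg a (C - s - 1) S (fun c => (S.cons c).freeInd s) =
          (C - s - 1) / (a + (C - s - 1)) * ((C - s - 1) / (C - s - 1 + 1)) ^ S.freeCount := by
      intro S
      have := colAvg_freeInd_last (a := a) (b := C - s - 1) S 1 1
      simpa using this
    simp only [h1]
    rw [avg_mul_left, avg_pow_freeCount_one_step ha hC, div_mul_div_cancel₀ (by positivity)]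
    exact le_of_eq (by congr 1; ring)
  | succ m ih =>
    push_cast at hC
    have h1 := avg_freeInd_succ_le ha hC (⟨s, by omega⟩ : Fin (s + 1 + m))
    have h2 : C - (s + 1 + (m + 1)) + 1 = C - (s + 1 + (m : ℝ)) := by ring
    rw [h2] at h1
    push_cast
    exact h1.trans (ih (by linarith))

/-- The crude estimate for the effect of one more column. -/
lemma norm_markAvg_one_succ_sub_le (ha : 0 < a) (hx : ‖x‖ ≤ 1) (hy : ‖y‖ ≤ 1) (s m : ℕ) {C : ℝ}
    (hC : 0 < C - (s + 1 + m + 1)) :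
    ‖markAvg x y (m + 2) a (C - (s + 1 + m + 1))
        (fun _ : StaircaseTableau (s + 1 + m + 1) => 1) -
      markAvg x y (m + 2) a (C - (s + 1 + m)) (fun _ : StaircaseTableau (s + 1 + m) => 1)‖ ≤
      4 * ((C - s - 1) / ((C - (s + 1 + m)) * (a + C - 1))) := by
  classical
  have h1 := markAvg_one_succ (x := x) (y := y) (k := m + 2) ha hC
    (⟨s, by omega⟩ : Fin (s + 1 + m)) (by simp; ring)
  have h2 : C - (s + 1 + m + 1) + 1 = C - (s + 1 + (m : ℝ)) := by ring
  rw [h2] at h1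
  have hC' : 0 < C - (s + 1 + (m : ℝ)) := by linarith
  have hxy : ‖x - y‖ ≤ 2 := (norm_sub_le _ _).trans (by linarith)
  have hy1 : ‖y - 1‖ ≤ 2 := (norm_sub_le _ _).trans (by rw [norm_one]; linarith)
  have h3 : avg a (C - (s + 1 + (m : ℝ))) (fun S : StaircaseTableau (s + 1 + m) =>
      |S.freeInd s * (1 / (C - (s + 1 + m)))|) ≤
      (C - s - 1) / ((C - (s + 1 + m)) * (a + C - 1)) := by
    have h4 : ∀ S : StaircaseTableau (s + 1 + m), |S.freeInd s * (1 / (C - (s + 1 + m)))| =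
        1 / (C - (s + 1 + m)) * S.freeInd s := fun S => by
      rw [mul_comm, abs_of_nonneg (mul_nonneg (by positivity) (freeInd_nonneg s S))]
    simp only [h4]
    rw [avg_mul_left, one_div_mul_eq_div, div_mul_eq_div_div_swap]
    exact div_le_div_of_nonneg_right (avg_freeInd_le ha s m hC') hC'.le
  have h4 : avg a (C - (s + 1 + (m : ℝ))) (fun S : StaircaseTableau (s + 1 + m) =>
      |S.freeInd s * (((C - (s + 1 + m + 1)) / (C - (s + 1 + m))) ^
        S.freeAbove ⟨s, by omega⟩ / (a + (C - (s + 1 + m + 1))))|) ≤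
      (C - s - 1) / ((C - (s + 1 + m)) * (a + C - 1)) := by
    refine le_trans (avg_mono ha hC' fun S => ?_) h3
    have h5 := colAvg_alpha ha hC S (⟨s, by omega⟩ : Fin (s + 1 + m))
    have h6 := colAvg_nonempty ha hC S (⟨s, by omega⟩ : Fin (s + 1 + m))
    rw [h2] at h5 h6
    have h7 := freeInd_eq (⟨s, by omega⟩ : Fin (s + 1 + m)) S
    simp only at h7
    -- The α term is dominated by comparing indicators before averaging: a box holding α is filled.
    have h8 : colAvg a (C - (s + 1 + m + 1)) S (fun c =>
        if c.1 (⟨s, by omega⟩ : Fin (s + 1 + m)).castSucc = some .alpha then (1 : ℝ) else 0) ≤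
        colAvg a (C - (s + 1 + m + 1)) S (fun c =>
        if c.1 (⟨s, by omega⟩ : Fin (s + 1 + m)).castSucc ≠ none then (1 : ℝ) else 0) := by
      refine colAvg_mono ha hC S fun c => ?_
      split_ifs with h9 h10
      · rfl
      · exact absurd (by rw [h9]; simp) h10
      · simp
      · rfl
    rw [h5, h6] at h8
    rw [h7]
    have h9 : 0 ≤ ((C - (s + 1 + m + 1)) / (C - (s + 1 + m))) ^
        S.freeAbove ⟨s, by omega⟩ / (a + (C - (s + 1 + m + 1))) :=
      div_nonneg (pow_nonneg (div_nonneg hC.le hC'.le) _) (by positivity)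
    split_ifs at h8 ⊢
    · rw [one_mul, one_mul, abs_of_nonneg h9, abs_of_nonneg (by positivity)]
      exact h8
    · simp
  have h5 := (norm_markAvg_le (x := x) (y := y) (k := m + 2) ha hC' hx hy _).trans h3
  have h6 := (norm_markAvg_le (x := x) (y := y) (k := m + 2) ha hC' hx hy _).trans h4
  rw [h1, add_assoc, add_sub_cancel_left]
  refine (norm_add_le _ _).trans ?_
  rw [norm_mul, norm_mul]
  have h7 := mul_le_mul hxy h6 (norm_nonneg _) (by norm_num)
  have h8 := mul_le_mul hy1 h5 (norm_nonneg _) (by norm_num)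
  linarith

/-- The logarithmic increment attributed to the column with `j` columns to its left. -/
noncomputable def increment (x y : ℂ) (n j : ℕ) : ℂ :=
  (x - y) * ((j : ℝ) / (n : ℝ) ^ 2 : ℝ) + (y - 1) * (1 / (n : ℝ) : ℝ)

lemma norm_increment_le (hx : ‖x‖ ≤ 1) (hy : ‖y‖ ≤ 1) {n j : ℕ} (hn : 0 < n) (hj : j ≤ n) :
    ‖increment x y n j‖ ≤ 4 / n := by
  have hxy : ‖x - y‖ ≤ 2 := (norm_sub_le _ _).trans (by linarith)
  have hy1 : ‖y - 1‖ ≤ 2 := (norm_sub_le _ _).trans (by rw [norm_one]; linarith)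
  have hn' : (0 : ℝ) < n := by exact_mod_cast hn
  have hj' : (j : ℝ) ≤ n := by exact_mod_cast hj
  have h1 : (j : ℝ) / (n : ℝ) ^ 2 ≤ 1 / n := by
    rw [div_le_div_iff₀ (by positivity) hn']
    nlinarith
  rw [increment]
  refine (norm_add_le _ _).trans ?_
  rw [norm_mul, norm_mul, Complex.norm_real, Complex.norm_real,
    Real.norm_of_nonneg (by positivity), Real.norm_of_nonneg (by positivity)]
  calc _ ≤ 2 * (1 / (n : ℝ)) + 2 * (1 / (n : ℝ)) := by gcongr
    _ = _ := by ring

/-- The real part of the increment is `x.re * (j / n ^ 2) + y.re * (1 / n - j / n ^ 2) - 1 / n`. The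
two coefficients are nonnegative with sum `1 / n`, so it is at most `0`. -/
lemma norm_exp_increment_le (hx : ‖x‖ ≤ 1) (hy : ‖y‖ ≤ 1) {n j : ℕ} (hn : 0 < n) (hj : j ≤ n) :
    ‖Complex.exp (increment x y n j)‖ ≤ 1 := by
  have hn' : (0 : ℝ) < n := by exact_mod_cast hn
  have hj' : (j : ℝ) ≤ n := by exact_mod_cast hj
  have h1 : (j : ℝ) / (n : ℝ) ^ 2 ≤ 1 / n := by
    rw [div_le_div_iff₀ (by positivity) hn']
    nlinarith
  have h0 : 0 ≤ (j : ℝ) / (n : ℝ) ^ 2 := by positivity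
  have hxr := (Complex.re_le_norm x).trans hx
  have hyr := (Complex.re_le_norm y).trans hy
  rw [Complex.norm_exp, Real.exp_le_one_iff, increment]
  simp only [Complex.add_re, Complex.re_mul_ofReal, Complex.sub_re, Complex.one_re]
  nlinarith

/-- The numerator is `j + O(1)` and the denominator `n ^ 2 + O(n)`, so the error is `O(1 / n ^ 2)`,
hence `O(1 / j ^ 2)`. -/
lemma abs_alpha_rate_sub_le {n j d b m M : ℝ} (hn : 4 ≤ n) (hj : 0 < j) (hjn : j ≤ n)
    (hd0 : 0 ≤ d) (hd : d ≤ 2 * M) (hb : 0 ≤ b) (hbM : b ≤ M) (hm : 0 ≤ m) :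
    |(b + m + j) / ((n + d - 1) * (n + d - 2)) - j / n ^ 2| ≤
      4 * (M + m + 4 * M ^ 2 + 10 * M + 5) / j ^ 2 := by
  have hM : 0 ≤ M := by linarith
  have hn0 : 0 < n := by linarith
  have hP : n ^ 2 / 4 ≤ (n + d - 1) * (n + d - 2) := by
    calc n ^ 2 / 4 = n / 2 * (n / 2) := by ring
      _ ≤ _ := mul_le_mul (by linarith) (by linarith) (by positivity) (by linarith)
  have hP0 : 0 < (n + d - 1) * (n + d - 2) := lt_of_lt_of_le (by positivity) hP
  rw [div_sub_div _ _ hP0.ne' (by positivity), abs_div, abs_of_pos (mul_pos hP0 (by positivity))]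
  have hq : |n ^ 2 - (n + d - 1) * (n + d - 2)| ≤ n * (4 * M ^ 2 + 10 * M + 5) := by
    have e : n ^ 2 - (n + d - 1) * (n + d - 2) = 3 * n + 3 * d - 2 * (n * d) - d ^ 2 - 2 := by ring
    have hd2 : d ^ 2 ≤ 4 * M ^ 2 := by nlinarith
    have h1 : n * d ≤ n * (2 * M) := by gcongr
    have h2 : 0 ≤ n * d := by positivity
    have h3 : M ≤ n * M := le_mul_of_one_le_left hM (by linarith)
    have h4 : M ^ 2 ≤ n * M ^ 2 := le_mul_of_one_le_left (by positivity) (by linarith)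
    have h5 : 0 ≤ d ^ 2 := by positivity
    have h6 : 0 ≤ n * M ^ 2 := by positivity
    rw [e, abs_le]
    constructor <;> linarith
  have hnum : |(b + m + j) * n ^ 2 - (n + d - 1) * (n + d - 2) * j| ≤
      n ^ 2 * (M + m + 4 * M ^ 2 + 10 * M + 5) := by
    have e : (b + m + j) * n ^ 2 - (n + d - 1) * (n + d - 2) * j =
        (b + m) * n ^ 2 + j * (n ^ 2 - (n + d - 1) * (n + d - 2)) := by ring
    rw [e]
    refine (abs_add_le _ _).trans ?_
    rw [abs_mul j, abs_of_pos hj, abs_of_nonneg (by positivity)]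
    calc _ ≤ (M + m) * n ^ 2 + n * (n * (4 * M ^ 2 + 10 * M + 5)) := by gcongr
      _ = _ := by ring
  calc _ ≤ n ^ 2 * (M + m + 4 * M ^ 2 + 10 * M + 5) / (n ^ 2 / 4 * n ^ 2) := by gcongr
    _ = 4 * (M + m + 4 * M ^ 2 + 10 * M + 5) / n ^ 2 := by field_simp
    _ ≤ _ := by gcongr

lemma abs_nonempty_rate_sub_le {n j d b m M : ℝ} (hn : 4 ≤ n) (hj : 0 < j) (hjn : j ≤ n)
    (hd0 : 0 ≤ d) (hd : d ≤ 2 * M) (hb : 0 ≤ b) (hm : 0 ≤ m) :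
    |(b + j + 1 + m) / ((b + j + 1) * (n + d - 1)) - 1 / n| ≤ (2 * m + 4 * M + 2) / j ^ 2 := by
  have hM : 0 ≤ M := by linarith
  have hn0 : 0 < n := by linarith
  have hP : 0 < n + d - 1 := by linarith
  have hQ : 0 < b + j + 1 := by positivity
  have e : (b + j + 1 + m) / ((b + j + 1) * (n + d - 1)) - 1 / n =
      m / ((b + j + 1) * (n + d - 1)) - (d - 1) / ((n + d - 1) * n) := by
    field_simp
    ring
  rw [e]
  refine (abs_sub _ _).trans ?_
  rw [abs_div, abs_div, abs_of_nonneg hm, abs_of_pos (mul_pos hQ hP), abs_of_pos (mul_pos hP hn0)]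
  have hd1 : |d - 1| ≤ 2 * M + 1 := by rw [abs_le]; constructor <;> linarith
  calc _ ≤ m / (j * (j / 2)) + (2 * M + 1) / (j / 2 * j) := by
        gcongr <;> linarith
    _ = _ := by field_simp; ring

/-- The sharp estimate for the effect of one more column, away from the boundary. -/
lemma norm_markAvg_one_succ_sub_exp_le {M : ℝ} (hM : 0 < M) (m : ℕ) :
    ∃ K : ℝ, 0 < K ∧ ∀ (x y : ℂ), ‖x‖ ≤ 1 → ‖y‖ ≤ 1 → ∀ a b : ℝ, 0 < a → a ≤ M → 0 < b → b ≤ M →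
      ∀ n s j : ℕ, 4 ≤ n → 1 ≤ j → n = s + 1 + m + 1 + j →
      ‖markAvg x y (m + 2) a (b + n - (s + 1 + m + 1))
          (fun _ : StaircaseTableau (s + 1 + m + 1) => 1) -
        Complex.exp (increment x y n j) * markAvg x y (m + 2) a (b + n - (s + 1 + m))
          (fun _ : StaircaseTableau (s + 1 + m) => 1)‖ ≤ K * √n / j ^ 2 := by
  set K1 : ℝ := 4 * (M + m + 4 * M ^ 2 + 10 * M + 5) with hK1
  set K2 : ℝ := 2 * m + 4 * M + 2 with hK2
  have hm0 : (0 : ℝ) ≤ m := m.cast_nonneg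
  have hK1' : 0 ≤ K1 := by positivity
  have hK2' : 0 ≤ K2 := by positivity
  -- Twice the α and filling errors, plus `16` from the second-order remainder of `exp`; `√s ≤ √n`
  -- and `1 ≤ √n` absorb everything into a multiple of `√n`.
  refine ⟨2 * (11 * m + 11 + K1 + K2) + 16, by positivity, ?_⟩
  intro x y hx hy a b ha haM hb hbM n s j hn hj hnj
  have hn4 : (4 : ℝ) ≤ n := by exact_mod_cast hn
  have hj1 : (1 : ℝ) ≤ j := by exact_mod_cast hj
  have hs0 : (0 : ℝ) ≤ s := s.cast_nonneg
  have hnj' : (n : ℝ) = s + 1 + m + 1 + j := by exact_mod_cast hnj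
  have hn0 : (0 : ℝ) < n := by linarith
  have hj0 : (0 : ℝ) < j := by linarith
  have hjn : (j : ℝ) ≤ n := by linarith
  have hxy : ‖x - y‖ ≤ 2 := (norm_sub_le _ _).trans (by linarith)
  have hy1 : ‖y - 1‖ ≤ 2 := (norm_sub_le _ _).trans (by rw [norm_one]; linarith)
  have hp : 1 / (n : ℝ) ≤ 1 / j := one_div_le_one_div_of_le hj0 hjn
  have hpα : (j : ℝ) / (n : ℝ) ^ 2 ≤ 1 / j := by
    refine le_trans ?_ hp
    rw [div_le_div_iff₀ (by positivity) hn0]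
    nlinarith
  set C : ℝ := b + n with hC
  have hCJ : (j : ℝ) ≤ C - (s + 1 + m + 1) := by rw [hC]; linarith
  have hk : 1 < m + 2 := by omega
  have hα := norm_markAvg_alpha_le ha hx hy hk hj0 (by positivity) hpα s m hCJ
  have hne := norm_markAvg_nonempty_le ha hx hy hk hj0 (by positivity) hp s m hCJ
  have h1 := markAvg_one_succ (x := x) (y := y) (k := m + 2) ha (hj0.trans_le hCJ)
    (⟨s, by omega⟩ : Fin (s + 1 + m)) (by simp; ring)
  have h2 : C - (s + 1 + m + 1) + 1 = C - (s + 1 + (m : ℝ)) := by ring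
  have h2' : C - ((s + 1 + m : ℕ) : ℝ) = C - (s + 1 + (m : ℝ)) := by push_cast; ring
  rw [h2] at h1
  rw [h2'] at hα hne
  have hsqrt : √s ≤ √n := Real.sqrt_le_sqrt (by linarith)
  have hsqrt1 : 1 ≤ √n := Real.one_le_sqrt.2 (by linarith)
  have hd0 : 0 < a + b := by positivity
  have hd : a + b ≤ 2 * M := by linarith
  have hA : |(C - s - 2) / ((a + C - 1) * (a + C - 2)) - (j : ℝ) / (n : ℝ) ^ 2| ≤
      K1 / (j : ℝ) ^ 2 := by
    have e1 : C - s - 2 = b + m + j := by rw [hC, hnj']; ring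
    have e2 : a + C - 1 = n + (a + b) - 1 := by rw [hC]; ring
    have e3 : a + C - 2 = n + (a + b) - 2 := by rw [hC]; ring
    rw [e1, e2, e3]
    exact abs_alpha_rate_sub_le hn4 hj0 hjn hd0.le hd hb.le hbM hm0
  have hB : |(C - s - 1) / ((C - (s + 1 + m)) * (a + C - 1)) - 1 / (n : ℝ)| ≤
      K2 / (j : ℝ) ^ 2 := by
    have e1 : C - (s + 1 + m) = b + j + 1 := by rw [hC, hnj']; ring
    have e2 : C - s - 1 = b + j + 1 + m := by rw [hC, hnj']; ring
    have e3 : a + C - 1 = n + (a + b) - 1 := by rw [hC]; ring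
    rw [e1, e2, e3]
    exact abs_nonempty_rate_sub_le hn4 hj0 hjn hd0.le hd hb.le hm0
  set T := markAvg x y (m + 2) a (C - (s + 1 + m)) (fun _ : StaircaseTableau (s + 1 + m) => 1)
    with hT
  have hT1 : ‖T‖ ≤ 1 := by
    refine (norm_markAvg_le ha (by linarith) hx hy _).trans ?_
    rw [abs_one, avg_const ha (by linarith)]
  have hsub : ∀ (g : StaircaseTableau (s + 1 + m) → ℝ) (p : ℝ),
      markAvg x y (m + 2) a (C - (s + 1 + m)) (fun S => g S - p) =
        markAvg x y (m + 2) a (C - (s + 1 + m)) g - p * T := by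
    intro g p
    simp only [hT, markAvg, ← avg_mul_left, ← avg_sub]
    congr 1
    funext S
    push_cast
    ring
  rw [hsub] at hα hne
  set w := increment x y n j with hw
  have hwn : ‖w‖ ≤ 4 / n := norm_increment_le hx hy (by omega) (by omega)
  have hw1 : ‖w‖ ≤ 1 := hwn.trans (div_le_one_of_le₀ hn4 hn0.le)
  have hexp : ‖Complex.exp w - 1 - w‖ ≤ 16 / (j : ℝ) ^ 2 := by
    refine (Complex.norm_exp_sub_one_sub_id_le hw1).trans ?_
    calc ‖w‖ ^ 2 ≤ (4 / n) ^ 2 := by gcongr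
      _ = 16 / (n : ℝ) ^ 2 := by ring
      _ ≤ _ := by gcongr
  set Qα := markAvg x y (m + 2) a (C - (s + 1 + m)) (fun S : StaircaseTableau (s + 1 + m) =>
    S.freeInd s * (((C - (s + 1 + m + 1)) / (C - (s + 1 + m))) ^
          S.freeAbove ⟨s, by omega⟩ / (a + (C - (s + 1 + m + 1)))))
  set Qn := markAvg x y (m + 2) a (C - (s + 1 + m)) (fun S : StaircaseTableau (s + 1 + m) =>
    S.freeInd s * (1 / (C - (s + 1 + m))))
  have key : markAvg x y (m + 2) a (C - (s + 1 + m + 1))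
          (fun _ : StaircaseTableau (s + 1 + m + 1) => 1) - Complex.exp w * T =
      (x - y) * (Qα - ((j : ℝ) / (n : ℝ) ^ 2 : ℝ) * T) + (y - 1) * (Qn - (1 / (n : ℝ) : ℝ) * T) -
        (Complex.exp w - 1 - w) * T := by
    rw [h1, hw, increment]
    ring
  rw [key]
  refine (norm_sub_le _ _).trans ((add_le_add (norm_add_le _ _) le_rfl).trans ?_)
  rw [norm_mul, norm_mul, norm_mul]
  have f1 := mul_le_mul hxy (hα.trans (add_le_add le_rfl hA)) (norm_nonneg _) (by norm_num)
  have f2 := mul_le_mul hy1 (hne.trans (add_le_add le_rfl hB)) (norm_nonneg _) (by norm_num)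
  have f3 := mul_le_mul hexp hT1 (norm_nonneg _) (by positivity)
  refine (add_le_add (add_le_add f1 f2) f3).trans ?_
  have : 2 * ((6 * m + 4 + 2 * √s) / (j : ℝ) ^ 2 + K1 / (j : ℝ) ^ 2) +
      2 * ((5 * m + 4 + √s) / (j : ℝ) ^ 2 + K2 / (j : ℝ) ^ 2) + 16 / (j : ℝ) ^ 2 * 1 =
      (2 * (11 * m + 8 + 3 * √s + K1 + K2) + 16) / (j : ℝ) ^ 2 := by ring
  rw [this]
  refine div_le_div_of_nonneg_right ?_ (by positivity)
  nlinarith [mul_nonneg (show (0 : ℝ) ≤ 22 * m + 16 + 2 * K1 + 2 * K2 + 16 by positivity)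
    (sub_nonneg.2 hsqrt1)]

end AllColumns

end StaircaseTableau

/-! ### Accumulating the one-column errors -/

/-- Since every multiplier has norm at most `1`, earlier errors are not amplified and simply add up.
-/
lemma norm_sub_exp_sum_le {D w : ℕ → ℂ} {err : ℕ → ℝ} {n : ℕ} (h0 : D 0 = 1)
    (hD : ∀ t < n, ‖D (t + 1) - Complex.exp (w t) * D t‖ ≤ err t)
    (hw : ∀ t < n, ‖Complex.exp (w t)‖ ≤ 1) :
    ‖D n - Complex.exp (∑ t ∈ Finset.range n, w t)‖ ≤ ∑ t ∈ Finset.range n, err t := by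
  induction n with
  | zero => simp [h0]
  | succ n ih =>
    have h1 := ih (fun t ht => hD t (by omega)) (fun t ht => hw t (by omega))
    rw [Finset.sum_range_succ, Finset.sum_range_succ, Complex.exp_add]
    have e : D (n + 1) - Complex.exp (∑ t ∈ Finset.range n, w t) * Complex.exp (w n) =
        (D (n + 1) - Complex.exp (w n) * D n) +
          Complex.exp (w n) * (D n - Complex.exp (∑ t ∈ Finset.range n, w t)) := by ring
    rw [e]
    refine (norm_add_le _ _).trans ?_
    rw [norm_mul, add_comm]
    exact add_le_add ((mul_le_of_le_one_left (norm_nonneg _) (hw n (by omega))).trans h1)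
      (hD n (by omega))

lemma sum_le_of_forall_le {err : ℕ → ℝ} {n k q : ℕ} {c e : ℝ} (hc : 0 ≤ c) (he : 0 ≤ e)
    (h1 : ∀ t < n, err t ≤ c) (h2 : ∀ t < n, k ≤ t → t + q < n → err t ≤ e) :
    ∑ t ∈ Finset.range n, err t ≤ k * c + q * c + n * e := by
  calc ∑ t ∈ Finset.range n, err t
      ≤ ∑ t ∈ Finset.range n, ((if t < k then c else 0) + (if n ≤ t + q then c else 0) + e) := by
        refine Finset.sum_le_sum fun t ht => ?_
        have ht' := Finset.mem_range.1 ht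
        have h3 := h1 t ht'
        split_ifs with h4 h5 h5
        · linarith
        · linarith
        · linarith
        · have := h2 t ht' (by omega) (by omega)
          linarith
    _ ≤ _ := by
        rw [Finset.sum_add_distrib, Finset.sum_add_distrib, ← Finset.sum_filter,
          ← Finset.sum_filter, Finset.sum_const, Finset.sum_const, Finset.sum_const,
          Finset.card_range, nsmul_eq_mul, nsmul_eq_mul, nsmul_eq_mul]
        have h3 : ((Finset.range n).filter (· < k)).card ≤ k := by
          refine (Finset.card_le_card (t := Finset.range k) fun t ht => ?_).trans_eq (by simp)
          simp at ht ⊢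
          exact ht.2
        have h4 : ((Finset.range n).filter (fun t => n ≤ t + q)).card ≤ q := by
          refine (Finset.card_le_card (t := Finset.Ico (n - q) n) fun t ht => ?_).trans
            (by simp; omega)
          simp at ht ⊢
          omega
        gcongr

namespace StaircaseTableau

variable {x y : ℂ}

lemma sum_increment (x y : ℂ) {n : ℕ} (hn : 0 < n) :
    ∑ t ∈ Finset.range n, increment x y n (n - 1 - t) =
      (x - y) * (1 / 2 - 1 / 2 * (1 / (n : ℝ)) : ℝ) + (y - 1) := by
  have hn' : (n : ℝ) ≠ 0 := by positivity
  rw [Finset.sum_range_reflect (fun j => increment x y n j) n]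
  simp only [increment]
  rw [Finset.sum_add_distrib, ← Finset.mul_sum, ← Complex.ofReal_sum, ← Finset.sum_div,
    Finset.sum_const, Finset.card_range, nsmul_eq_mul]
  have h1 : ∑ j ∈ Finset.range n, (j : ℝ) = n * (n - 1) / 2 := by
    have h := Finset.sum_range_id_mul_two n
    have h2 : ((∑ j ∈ Finset.range n, j : ℕ) : ℝ) * 2 = n * ((n - 1 : ℕ) : ℝ) := by
      exact_mod_cast h
    rw [Nat.cast_sub (by omega : 1 ≤ n), Nat.cast_one, Nat.cast_sum] at h2
    linarith
  rw [h1]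
  congr 1
  · congr 2
    field_simp
  · rw [mul_left_comm, ← Complex.ofReal_natCast, ← Complex.ofReal_mul, mul_one_div_cancel hn']
    simp

lemma markAvg_zero (k : ℕ) (a b : ℝ) (ha : 0 < a) (hb : 0 < b) :
    markAvg x y k a b (fun _ : StaircaseTableau 0 => 1) = 1 := by
  have h : ∀ S : StaircaseTableau 0, S.mark x y k = 1 := fun S => by simp [mark, diagCount]
  simp only [markAvg, h]
  rw [avg_const ha hb]
  simp

lemma norm_markAvg_sub_exp_sum_le {M : ℝ} (hM : 0 < M) (m : ℕ) :
    ∃ K : ℝ, 0 < K ∧ ∀ (x y : ℂ), ‖x‖ ≤ 1 → ‖y‖ ≤ 1 → ∀ a b : ℝ, 0 < a → a ≤ M → 0 < b → b ≤ M →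
      ∀ n q : ℕ, 4 ≤ n → 1 ≤ q →
      ‖markAvg x y (m + 2) a b (fun _ : StaircaseTableau n => 1) -
        Complex.exp ((x - y) * (1 / 2 - 1 / 2 * (1 / (n : ℝ)) : ℝ) + (y - 1))‖ ≤
        (m + 1) * ((8 * m + 16) / n) + q * ((8 * m + 16) / n) + n * (K * √n / q ^ 2) := by
  obtain ⟨K, hK, h⟩ := norm_markAvg_one_succ_sub_exp_le hM m
  refine ⟨K, hK, fun x y hx hy a b ha haM hb hbM n q hn hq => ?_⟩
  have hn0 : (0 : ℝ) < n := by positivity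
  have hn4 : (4 : ℝ) ≤ n := by exact_mod_cast hn
  have hq0 : (0 : ℝ) < q := by positivity
  have hm0 : (0 : ℝ) ≤ m := m.cast_nonneg
  -- The generating function after `t` of the `n` columns; each column still to come raises the
  -- second parameter by one.
  set D : ℕ → ℂ := fun t => markAvg x y (m + 2) a (b + n - t) (fun _ : StaircaseTableau t => 1)
    with hD
  set w : ℕ → ℂ := fun t => increment x y n (n - 1 - t) with hw
  have hB : ∀ t : ℕ, t ≤ n → 0 < b + n - t := fun t ht => by
    have : (t : ℝ) ≤ n := by exact_mod_cast ht
    linarith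
  have hD1 : ∀ t ≤ n, ‖D t‖ ≤ 1 := fun t ht => by
    refine (norm_markAvg_le ha (hB t ht) hx hy _).trans ?_
    rw [abs_one, avg_const ha (hB t ht)]
  have hDn : D n = markAvg x y (m + 2) a b (fun _ : StaircaseTableau n => 1) := by
    simp only [hD, add_sub_cancel_right]
  have hws : ∀ t < n, ‖Complex.exp (w t) - 1‖ ≤ 8 / n := fun t ht => by
    have h1 : ‖w t‖ ≤ 4 / n := norm_increment_le hx hy (by omega) (by omega)
    refine (Complex.norm_exp_sub_one_le (h1.trans (div_le_one_of_le₀ hn4 hn0.le))).trans ?_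
    calc 2 * ‖w t‖ ≤ 2 * (4 / n) := by gcongr
      _ = _ := by ring
  have hstep : ∀ t < n, ‖D (t + 1) - D t‖ ≤ (8 * m + 8) / n := by
    intro t ht
    rcases lt_or_ge t (m + 1) with h1 | h1
    · have h2 := markAvg_one_succ_of_lt (n := t) (k := m + 2) (x := x) (y := y) ha
        (hB (t + 1) (by omega)) (by omega)
      have h3 : b + n - ((t + 1 : ℕ) : ℝ) + 1 = b + n - t := by push_cast; ring
      rw [h3] at h2
      simp only [hD]
      rw [h2, sub_self, norm_zero]
      positivity
    · obtain ⟨s, rfl⟩ : ∃ s, t = s + 1 + m := ⟨t - 1 - m, by omega⟩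
      have h2 := norm_markAvg_one_succ_sub_le (x := x) (y := y) (C := b + n) ha hx hy s m (by
        have := hB (s + 1 + m + 1) (by omega)
        push_cast at this
        linarith)
      -- With `X = b + n - (s + 1 + m) ≥ 1` the first ratio is `(X + m) / X ≤ m + 1`.
      have h3 : (b + n - s - 1) / ((b + n - (s + 1 + m)) * (a + (b + n) - 1)) ≤
          (m + 1) * (2 / n) := by
        have h4 := hB (s + 1 + m + 1) (by omega)
        push_cast at h4
        have h5 : 1 ≤ b + n - (s + 1 + m) := by
          have : ((s + 1 + m + 1 : ℕ) : ℝ) ≤ n := by exact_mod_cast ht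
          push_cast at this
          linarith
        rw [← div_div, div_eq_mul_one_div]
        refine mul_le_mul ?_ ?_ (one_div_nonneg.2 (by linarith)) (by positivity)
        · rw [div_le_iff₀ (by linarith)]
          nlinarith
        · rw [div_le_div_iff₀ (by linarith) hn0]
          linarith
      simp only [hD]
      push_cast
      refine h2.trans ((mul_le_mul_of_nonneg_left h3 (by norm_num)).trans_eq ?_)
      ring
  have hcrude : ∀ t < n, ‖D (t + 1) - Complex.exp (w t) * D t‖ ≤ (8 * m + 16) / n := by
    intro t ht
    have e : D (t + 1) - Complex.exp (w t) * D t =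
        (D (t + 1) - D t) - (Complex.exp (w t) - 1) * D t := by ring
    rw [e]
    refine (norm_sub_le _ _).trans ?_
    rw [norm_mul]
    calc _ ≤ (8 * m + 8) / (n : ℝ) + 8 / n * 1 :=
          add_le_add (hstep t ht) (mul_le_mul (hws t ht) (hD1 t ht.le) (norm_nonneg _)
            (by positivity))
      _ = _ := by ring
  have hsharp : ∀ t < n, m + 1 ≤ t → t + q < n →
      ‖D (t + 1) - Complex.exp (w t) * D t‖ ≤ K * √n / q ^ 2 := by
    intro t ht h1 h2
    obtain ⟨s, rfl⟩ : ∃ s, t = s + 1 + m := ⟨t - 1 - m, by omega⟩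
    have hqj : (q : ℝ) ≤ (n - 1 - (s + 1 + m) : ℕ) := by
      exact_mod_cast (by omega : q ≤ n - 1 - (s + 1 + m))
    have h3 := h x y hx hy a b ha haM hb hbM n s (n - 1 - (s + 1 + m)) hn (by omega) (by omega)
    simp only [hD, hw]
    push_cast
    refine h3.trans ?_
    gcongr
  have hfin := norm_sub_exp_sum_le (D := D) (w := w) (n := n)
    (err := fun t => ‖D (t + 1) - Complex.exp (w t) * D t‖)
    (by simp only [hD]; exact markAvg_zero _ _ _ ha (hB 0 (by omega)))
    (fun t _ => le_rfl) (fun t ht => norm_exp_increment_le hx hy (by omega) (by omega))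
  rw [hDn, sum_increment x y (by omega)] at hfin
  refine hfin.trans ((sum_le_of_forall_le (k := m + 1) (q := q) (by positivity) (by positivity)
    hcrude hsharp).trans_eq ?_)
  push_cast
  ring

/-- The generating function of the numbers of `α`'s and `β`'s on the `k`-th diagonal converges,
uniformly in the parameters. -/
theorem eventually_norm_markAvg_sub_le {k : ℕ} (hk : 1 < k) {M : ℝ} (hM : 0 < M) (hx : ‖x‖ ≤ 1)
    (hy : ‖y‖ ≤ 1) {ε : ℝ} (hε : 0 < ε) :
    ∀ᶠ n : ℕ in atTop, ∀ a b : ℝ, 0 < a → a ≤ M → 0 < b → b ≤ M →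
      ‖markAvg x y k a b (fun _ : StaircaseTableau n => 1) -
        Complex.exp ((x - 1) / 2 + (y - 1) / 2)‖ ≤ ε := by
  obtain ⟨m, rfl⟩ : ∃ m, k = m + 2 := ⟨k - 2, by omega⟩
  obtain ⟨K, hK, h⟩ := norm_markAvg_sub_exp_sum_le hM m
  have hc : (0 : ℝ) < 8 * m + 16 := by positivity
  set c : ℝ := 8 * m + 16 with hcdef
  -- With `q` about `δ * n`, the crude bound on the last `q` columns tends to `c * δ = ε / 4`, while
  -- the sharp bounds add up to `O(1 / √n)`.
  set δ : ℝ := ε / (4 * c) with hδ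
  have hδ0 : 0 < δ := by positivity
  have h1 : Tendsto (fun n : ℕ => Complex.exp ((x - y) * (1 / 2 - 1 / 2 * (1 / (n : ℝ)) : ℝ) +
      (y - 1))) atTop (𝓝 (Complex.exp ((x - 1) / 2 + (y - 1) / 2))) := by
    have h2 : Tendsto (fun n : ℕ => (1 / 2 - 1 / 2 * (1 / (n : ℝ)) : ℝ)) atTop
        (𝓝 (1 / 2 - 1 / 2 * 0)) :=
      tendsto_const_nhds.sub (tendsto_const_nhds.mul tendsto_one_div_atTop_nhds_zero_nat)
    have h3 := ((Complex.continuous_exp.comp (by fun_prop :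
      Continuous fun r : ℝ => (x - y) * (r : ℂ) + (y - 1))).tendsto _).comp h2
    have h4 : (x - y) * ((1 / 2 - 1 / 2 * 0 : ℝ) : ℂ) + (y - 1) = (x - 1) / 2 + (y - 1) / 2 := by
      push_cast; ring
    simp only [Function.comp_def] at h3
    rw [h4] at h3
    exact h3
  have h2 : Tendsto (fun n : ℕ => (m + 2) * c * (1 / (n : ℝ)) + c * δ + K / δ ^ 2 * (1 / √n)) atTop
      (𝓝 ((m + 2) * c * 0 + c * δ + K / δ ^ 2 * 0)) := by
    refine ((tendsto_const_nhds.mul tendsto_one_div_atTop_nhds_zero_nat).add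
      tendsto_const_nhds).add (tendsto_const_nhds.mul ?_)
    exact tendsto_const_nhds.div_atTop (Real.tendsto_sqrt_atTop.comp tendsto_natCast_atTop_atTop)
  have h3 : (m + 2) * c * 0 + c * δ + K / δ ^ 2 * 0 < ε / 2 := by
    have : c * δ = ε / 4 := by rw [hδ]; field_simp
    linarith
  filter_upwards [h2.eventually_lt_const h3, Metric.tendsto_nhds.1 h1 (ε / 2) (by positivity),
    eventually_ge_atTop 4] with n hn1 hn2 hn3 a b ha haM hb hbM
  have hn0 : (0 : ℝ) < n := by positivity
  set q : ℕ := ⌈δ * n⌉₊ with hq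
  have hq1 : 1 ≤ q := Nat.one_le_ceil_iff.2 (by positivity)
  have hq2 : δ * n ≤ q := Nat.le_ceil _
  have hq3 : (q : ℝ) ≤ δ * n + 1 := (Nat.ceil_lt_add_one (by positivity)).le
  have h4 := h x y hx hy a b ha haM hb hbM n q hn3 hq1
  rw [dist_eq_norm] at hn2
  have h5 : (m + 1) * (c / n) + q * (c / n) + n * (K * √n / q ^ 2) ≤
      (m + 2) * c * (1 / (n : ℝ)) + c * δ + K / δ ^ 2 * (1 / √n) := by
    calc _ ≤ (m + 1) * (c / n) + (δ * n + 1) * (c / n) + n * (K * √n / (δ * n) ^ 2) := by gcongr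
      _ = (m + 2) * c * (1 / (n : ℝ)) + c * δ + K / δ ^ 2 * (√n / n) := by
          field_simp
          ring
      _ = _ := by rw [Real.sqrt_div_self, one_div (√(n : ℝ))]
  have h6 := norm_sub_le_norm_sub_add_norm_sub
    (markAvg x y (m + 2) a b (fun _ : StaircaseTableau n => 1))
    (Complex.exp ((x - y) * (1 / 2 - 1 / 2 * (1 / (n : ℝ)) : ℝ) + (y - 1)))
    (Complex.exp ((x - 1) / 2 + (y - 1) / 2))
  linarith

end StaircaseTableau

/-! ### From the weights in `α`, `β` to the dual weights -/

namespace StaircaseTableau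

section Prob

variable {n : ℕ}

/-- Of two β's in a row, the western one would violate the filling rule, so each row has exactly one
β or is free. -/
lemma count_beta_add_freeCount (S : StaircaseTableau n) : S.count .beta + S.freeCount = n := by
  classical
  have h : ∀ i, (∑ j, if S.1 i j = some .beta then 1 else 0) + (if S.freeRow i then 1 else 0) =
      1 := by
    intro i
    by_cases hi : S.freeRow i
    · rw [Finset.sum_eq_zero fun j _ => if_neg (hi j), if_pos hi]
    · obtain ⟨j, hj⟩ : ∃ j, S.1 i j = some .beta := by simpa [freeRow] using hi
      rw [if_neg hi, Finset.sum_eq_single j, if_pos hj]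
      · intro j' _ hj'
        refine if_neg fun h => ?_
        rcases lt_or_gt_of_ne hj' with h1 | h1
        · simp [S.2.west_beta i j hj j' h1] at h
        · simp [S.2.west_beta i j' h j h1] at hj
      · simp
  rw [count, freeCount, Finset.card_filter, Finset.card_filter, Fintype.sum_prod_type,
    ← Finset.sum_add_distrib]
  exact (Finset.sum_congr rfl fun i _ => h i).trans (by simp)

lemma count_alpha_add_freeColCount (S : StaircaseTableau n) :
    S.count .alpha + S.freeColCount = n := by
  classical
  have h : ∀ j, (∑ i, if S.1 i j = some .alpha then 1 else 0) +
      (if ∀ i, S.1 i j ≠ some .alpha then 1 else 0) = 1 := by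
    intro j
    by_cases hj : ∀ i, S.1 i j ≠ some .alpha
    · rw [Finset.sum_eq_zero fun i _ => if_neg (hj i), if_pos hj]
    · obtain ⟨i, hi⟩ : ∃ i, S.1 i j = some .alpha := by simpa using hj
      rw [if_neg hj, Finset.sum_eq_single i, if_pos hi]
      · intro i' _ hi'
        refine if_neg fun h => ?_
        rcases lt_or_gt_of_ne hi' with h1 | h1
        · simp [S.2.north_alpha i j hi i' h1] at h
        · simp [S.2.north_alpha i' j h i h1] at hi
      · simp
  rw [count, freeColCount, Finset.card_filter, Finset.card_filter, Fintype.sum_prod_type_right,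
    ← Finset.sum_add_distrib]
  exact (Finset.sum_congr rfl fun j _ => h j).trans (by simp)

lemma weight_eq_dualWeight {α β : ℝ} (hα : 0 < α) (hβ : 0 < β) (S : StaircaseTableau n) :
    S.weight α β = (α ^ n * β ^ n) * S.dualWeight (1 / α) (1 / β) := by
  have h1 : α ^ n = α ^ S.count .alpha * α ^ S.freeColCount := by
    rw [← pow_add, count_alpha_add_freeColCount]
  have h2 : β ^ n = β ^ S.count .beta * β ^ S.freeCount := by
    rw [← pow_add, count_beta_add_freeCount]
  rw [weight, dualWeight, h1, h2, one_div_pow, one_div_pow]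
  field_simp

lemma prob_eq_dualWeight_div {α β : ℝ} (hα : 0 < α) (hβ : 0 < β) (S : StaircaseTableau n) :
    S.prob α β = S.dualWeight (1 / α) (1 / β) / dualPartition n (1 / α) (1 / β) := by
  rw [prob, partitionFunction]
  simp only [weight_eq_dualWeight hα hβ, ← Finset.mul_sum, sum_dualWeight]
  rw [mul_div_mul_left _ _ (by positivity)]

lemma weight_pos {α β : ℝ} (hα : 0 < α) (hβ : 0 < β) (S : StaircaseTableau n) :
    0 < S.weight α β := by
  rw [weight]; positivity

lemma prob_nonneg {α β : ℝ} (hα : 0 < α) (hβ : 0 < β) (S : StaircaseTableau n) :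
    0 ≤ S.prob α β :=
  div_nonneg (weight_pos hα hβ S).le (Finset.sum_nonneg fun S _ => (weight_pos hα hβ S).le)

lemma sum_prob {α β : ℝ} (hα : 0 < α) (hβ : 0 < β) :
    ∑ S : StaircaseTableau n, S.prob α β = 1 := by
  simp only [prob_eq_dualWeight_div hα hβ]
  exact sum_dualProb (by positivity) (by positivity)

lemma prob_le_one {α β : ℝ} (hα : 0 < α) (hβ : 0 < β) (S : StaircaseTableau n) :
    S.prob α β ≤ 1 := by
  rw [← sum_prob (n := n) hα hβ]
  exact Finset.single_le_sum (fun S _ => prob_nonneg hα hβ S) (Finset.mem_univ S)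

end Prob

end StaircaseTableau

open StaircaseTableau

/-! ### Limits along the parameter regimes -/

/-- A rational function has a limit at infinity unless its numerator has larger degree, in which
case it is unbounded. -/
lemma Polynomial.exists_tendsto_div_of_bounded (P Q : Polynomial ℝ)
    (h : ∀ᶠ t in atTop, |P.eval t / Q.eval t| ≤ 1) :
    ∃ c, Tendsto (fun t => P.eval t / Q.eval t) atTop (𝓝 c) := by
  by_cases hQ : Q = 0
  · exact ⟨0, by simp [hQ]⟩
  rcases lt_trichotomy P.degree Q.degree with h1 | h1 | h1
  · exact ⟨0, P.div_tendsto_atTop_zero_of_degree_lt Q h1⟩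
  · exact ⟨_, P.div_tendsto_atTop_leadingCoeff_div_of_degree_eq Q h1⟩
  · have h2 := P.abs_div_tendsto_atTop_atTop_of_degree_gt Q h1 hQ
    obtain ⟨t, h3, h4⟩ := (h.and (h2.eventually_gt_atTop 1)).exists
    linarith

/-- Along polynomial parameters a probability is a rational function with values in `[0, 1]`; taking
`A` and `B` to be `X` or constants covers the three infinite regimes. -/
lemma exists_tendsto_prob_polynomial (A B : Polynomial ℝ)
    (hA : ∀ t : ℝ, 0 < t → 0 < A.eval t) (hB : ∀ t : ℝ, 0 < t → 0 < B.eval t)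
    {n : ℕ} (S : StaircaseTableau n) :
    ∃ c, Tendsto (fun w : ℝ × ℝ => S.prob w.1 w.2) (map (fun t => (A.eval t, B.eval t)) atTop)
      (𝓝 c) := by
  set W : StaircaseTableau n → Polynomial ℝ := fun S => A ^ S.count .alpha * B ^ S.count .beta
  have h : ∀ t, S.prob (A.eval t) (B.eval t) = (W S).eval t / (∑ S, W S).eval t := by
    intro t
    simp [W, prob, partitionFunction, weight, Polynomial.eval_finsetSum]
  obtain ⟨c, hc⟩ := (W S).exists_tendsto_div_of_bounded (∑ S, W S) (by
    filter_upwards [eventually_gt_atTop 0] with t ht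
    rw [← h, abs_of_nonneg (prob_nonneg (hA t ht) (hB t ht) S)]
    exact prob_le_one (hA t ht) (hB t ht) S)
  refine ⟨c, tendsto_map'_iff.2 (hc.congr fun t => (h t).symm)⟩

namespace IsParameterRegime

variable {L : Filter (ℝ × ℝ)}

lemma neBot (hL : IsParameterRegime L) : L.NeBot := by
  cases hL <;> infer_instance

lemma exists_tendsto_prob (hL : IsParameterRegime L) {n : ℕ} (S : StaircaseTableau n) :
    ∃ c, Tendsto (fun w : ℝ × ℝ => S.prob w.1 w.2) L (𝓝 c) := by
  cases hL with
  | fixed α β hα hβ => exact ⟨_, tendsto_pure_nhds _ _⟩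
  | alphaInfinite β hβ =>
    simpa using exists_tendsto_prob_polynomial .X (.C β) (by simp) (by simp [hβ]) S
  | betaInfinite α hα =>
    simpa using exists_tendsto_prob_polynomial (.C α) .X (by simp [hα]) (by simp) S
  | bothInfinite => simpa using exists_tendsto_prob_polynomial .X .X (by simp) (by simp) S

lemma exists_bound (hL : IsParameterRegime L) :
    ∃ M : ℝ, 0 < M ∧ ∀ᶠ w in L, 0 < w.1 ∧ 0 < w.2 ∧ 1 / w.1 ≤ M ∧ 1 / w.2 ≤ M := by
  cases hL with
  | fixed α β hα hβ =>
    exact ⟨max (1 / α) (1 / β), by positivity, by simp [hα, hβ]⟩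
  | alphaInfinite β hβ =>
    refine ⟨max 1 (1 / β), by positivity, eventually_map.2 ?_⟩
    filter_upwards [eventually_ge_atTop 1] with t ht
    exact ⟨zero_lt_one.trans_le ht, hβ, le_max_of_le_left ((div_le_one (by linarith)).2 ht),
      le_max_right _ _⟩
  | betaInfinite α hα =>
    refine ⟨max 1 (1 / α), by positivity, eventually_map.2 ?_⟩
    filter_upwards [eventually_ge_atTop 1] with t ht
    exact ⟨hα, zero_lt_one.trans_le ht, le_max_right _ _,
      le_max_of_le_left ((div_le_one (by linarith)).2 ht)⟩
  | bothInfinite =>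
    refine ⟨1, one_pos, eventually_map.2 ?_⟩
    filter_upwards [eventually_ge_atTop 1] with t ht
    exact ⟨zero_lt_one.trans_le ht, zero_lt_one.trans_le ht, (div_le_one (by linarith)).2 ht,
      (div_le_one (by linarith)).2 ht⟩

/-- The law of the random tableau. -/
lemma exists_law (hL : IsParameterRegime L) (n : ℕ) :
    ∃ P : ProbabilityMeasure (StaircaseTableau n), ∀ S : StaircaseTableau n,
      Tendsto (fun w : ℝ × ℝ => S.prob w.1 w.2) L
        (𝓝 ((P : Measure (StaircaseTableau n)).real {S})) := by
  have := hL.neBot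
  obtain ⟨M, -, hM⟩ := hL.exists_bound
  choose p hp using fun S : StaircaseTableau n => hL.exists_tendsto_prob S
  have hp0 : ∀ S, 0 ≤ p S := fun S =>
    ge_of_tendsto (hp S) (hM.mono fun w hw => prob_nonneg hw.1 hw.2.1 S)
  have hp1 : ∑ S, p S = 1 :=
    tendsto_nhds_unique (tendsto_finsetSum _ fun S _ => hp S)
      (tendsto_const_nhds.congr' (hM.mono fun w hw => (sum_prob hw.1 hw.2.1).symm))
  let q : PMF (StaircaseTableau n) := PMF.ofFintype (fun S => ENNReal.ofReal (p S)) (by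
    rw [← ENNReal.ofReal_sum_of_nonneg fun S _ => hp0 S, hp1, ENNReal.ofReal_one])
  refine ⟨⟨q.toMeasure, inferInstance⟩, fun S => ?_⟩
  have : (q.toMeasure).real {S} = p S := by
    rw [measureReal_def, PMF.toMeasure_apply_singleton _ _ (measurableSet_singleton S)]
    exact ENNReal.toReal_ofReal (hp0 S)
  exact this ▸ hp S

lemma tendsto_integral_mark (hL : IsParameterRegime L) {k : ℕ} (hk : 1 < k)
    {P : ∀ n : ℕ, ProbabilityMeasure (StaircaseTableau n)}
    (hP : ∀ (n : ℕ) (S : StaircaseTableau n), Tendsto (fun w : ℝ × ℝ => S.prob w.1 w.2) L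
      (𝓝 ((P n : Measure (StaircaseTableau n)).real {S})))
    {x y : ℂ} (hx : ‖x‖ ≤ 1) (hy : ‖y‖ ≤ 1) :
    Tendsto (fun n => ∫ S, S.mark x y k ∂(P n : Measure (StaircaseTableau n))) atTop
      (𝓝 (Complex.exp ((x - 1) / 2 + (y - 1) / 2))) := by
  have := hL.neBot
  obtain ⟨M, hM0, hM⟩ := hL.exists_bound
  have h1 : ∀ n, Tendsto (fun w : ℝ × ℝ =>
      markAvg x y k (1 / w.1) (1 / w.2) (fun _ : StaircaseTableau n => 1)) L
      (𝓝 (∫ S, S.mark x y k ∂(P n : Measure (StaircaseTableau n)))) := by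
    intro n
    rw [integral_fintype .of_finite]
    refine (tendsto_finsetSum _ fun S _ => (hP n S).smul_const (S.mark x y k)).congr' ?_
    filter_upwards [hM] with w hw
    rw [markAvg, avg]
    refine Finset.sum_congr rfl fun S _ => ?_
    rw [prob_eq_dualWeight_div hw.1 hw.2.1, Complex.ofReal_one, mul_one]
  rw [Metric.tendsto_nhds]
  intro ε hε
  filter_upwards [eventually_norm_markAvg_sub_le hk hM0 hx hy (half_pos hε)] with n hn
  rw [dist_eq_norm]
  refine lt_of_le_of_lt ?_ (half_lt_self hε)
  -- For fixed `n` the bound holds eventually along `L`, uniformly in the parameters, so it passes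
  -- to the limit law before `n → ∞`.
  refine le_of_tendsto ((h1 n).sub_const _).norm (hM.mono fun w hw => ?_)
  exact hn _ _ (one_div_pos.2 hw.1) hw.2.2.1 (one_div_pos.2 hw.2.1) hw.2.2.2

end IsParameterRegime

/-! ### Convergence in distribution of pairs of natural numbers -/

/-- Every open set of `X` is the preimage of an open set of `Y`, so the portmanteau criterion on
open sets pulls back. It transfers Lévy's theorem from `ℂ` to `ℕ × ℕ`. -/
lemma tendsto_of_tendsto_map_of_isInducing {X Y : Type*} [TopologicalSpace X]
    [MeasurableSpace X] [BorelSpace X] [TopologicalSpace Y] [MeasurableSpace Y] [BorelSpace Y]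
    [HasOuterApproxClosed Y] {ι : X → Y} (hι : IsInducing ι) {μs : ℕ → ProbabilityMeasure X}
    {μ : ProbabilityMeasure X}
    (h : Tendsto (fun n => (μs n).map hι.continuous.measurable.aemeasurable) atTop
      (𝓝 (μ.map hι.continuous.measurable.aemeasurable))) : Tendsto μs atTop (𝓝 μ) := by
  refine tendsto_of_forall_isOpen_le_liminf' fun G hG => ?_
  obtain ⟨U, hU, rfl⟩ := hι.isOpen_iff.1 hG
  have h1 := ProbabilityMeasure.le_liminf_measure_open_of_tendsto h hU
  simpa only [ProbabilityMeasure.toMeasure_map,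
    Measure.map_apply hι.continuous.measurable hU.measurableSet] using h1

/-- The embedding of pairs of natural numbers as Gaussian integers. -/
def natPairToComplex (p : ℕ × ℕ) : ℂ := ⟨p.1, p.2⟩

lemma isInducing_natPairToComplex : IsInducing natPairToComplex := by
  have h := Complex.equivRealProdCLM.symm.toHomeomorph.isInducing.comp
    (Nat.isClosedEmbedding_coe_real.isInducing.prodMap Nat.isClosedEmbedding_coe_real.isInducing)
  exact h

/-- For the real inner product on `ℂ` the characteristic function is the joint generating function
at two points of the unit circle. -/
lemma charFun_map_natPairToComplex (μ : Measure (ℕ × ℕ)) (t : ℂ) :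
    charFun (μ.map natPairToComplex) t =
      ∫ p, Complex.exp (t.re * Complex.I) ^ p.1 * Complex.exp (t.im * Complex.I) ^ p.2 ∂μ := by
  rw [charFun_apply, integral_map isInducing_natPairToComplex.continuous.measurable.aemeasurable
    (by fun_prop)]
  refine integral_congr_ae (ae_of_all _ fun p => ?_)
  simp only
  rw [← Complex.exp_nat_mul, ← Complex.exp_nat_mul, ← Complex.exp_add]
  congr 1
  rw [Complex.inner]
  simp [natPairToComplex]
  ring

lemma integral_pow_poissonMeasure (r : NNReal) (t : ℝ) :
    ∫ n, Complex.exp (t * Complex.I) ^ n ∂(poissonMeasure r) =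
      Complex.exp (r * (Complex.exp (t * Complex.I) - 1)) := by
  rw [← charFun_map_cast_poissonMeasure, charFun_apply,
    integral_map (.of_discrete) (by fun_prop)]
  refine integral_congr_ae (ae_of_all _ fun p => ?_)
  simp only
  rw [← Complex.exp_nat_mul]
  congr 1
  simp
  ring

namespace IsParameterRegime

variable {L : Filter (ℝ × ℝ)}

lemma tendstoInDistribution_diagCount (hL : IsParameterRegime L) {k : ℕ} (hk : 1 < k)
    {P : ∀ n : ℕ, ProbabilityMeasure (StaircaseTableau n)}
    (hP : ∀ (n : ℕ) (S : StaircaseTableau n), Tendsto (fun w : ℝ × ℝ => S.prob w.1 w.2) L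
      (𝓝 ((P n : Measure (StaircaseTableau n)).real {S})))
    {Ω : Type*} [MeasurableSpace Ω] (μ : Measure Ω) [IsProbabilityMeasure μ]
    (Z₁ Z₂ : Ω → ℕ) (h₁ : HasLaw Z₁ (poissonMeasure (1 / 2)) μ)
    (h₂ : HasLaw Z₂ (poissonMeasure (1 / 2)) μ) (h₁₂ : IndepFun Z₁ Z₂ μ) :
    TendstoInDistribution
      (fun (n : ℕ) (S : StaircaseTableau n) => (S.diagCount k .alpha, S.diagCount k .beta))
      atTop (fun ω => (Z₁ ω, Z₂ ω)) (fun n => (P n : Measure (StaircaseTableau n))) μ := by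
  refine ⟨fun n => .of_discrete, h₁.aemeasurable.prodMk h₂.aemeasurable, ?_⟩
  refine tendsto_of_tendsto_map_of_isInducing isInducing_natPairToComplex ?_
  refine ProbabilityMeasure.tendsto_of_tendsto_charFun fun t => ?_
  change Tendsto (fun n => charFun (((P n : Measure (StaircaseTableau n)).map fun S =>
      (S.diagCount k .alpha, S.diagCount k .beta)).map natPairToComplex) t) atTop
    (𝓝 (charFun ((μ.map fun ω => (Z₁ ω, Z₂ ω)).map natPairToComplex) t))
  simp only [charFun_map_natPairToComplex]
  have hx : ‖Complex.exp (t.re * Complex.I)‖ ≤ 1 := (Complex.norm_exp_ofReal_mul_I _).le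
  have hy : ‖Complex.exp (t.im * Complex.I)‖ ≤ 1 := (Complex.norm_exp_ofReal_mul_I _).le
  have h := hL.tendsto_integral_mark hk hP hx hy
  have hlim : ∫ p, Complex.exp (t.re * Complex.I) ^ p.1 * Complex.exp (t.im * Complex.I) ^ p.2
      ∂(μ.map fun ω => (Z₁ ω, Z₂ ω)) = Complex.exp ((Complex.exp (t.re * Complex.I) - 1) / 2 +
        (Complex.exp (t.im * Complex.I) - 1) / 2) := by
    rw [(indepFun_iff_map_prod_eq_prod_map_map h₁.aemeasurable h₂.aemeasurable).1 h₁₂, h₁.map_eq,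
      h₂.map_eq, integral_prod_mul (fun n : ℕ => Complex.exp (t.re * Complex.I) ^ n)
        (fun n : ℕ => Complex.exp (t.im * Complex.I) ^ n), integral_pow_poissonMeasure,
      integral_pow_poissonMeasure, ← Complex.exp_add]
    congr 1
    push_cast
    ring
  rw [hlim]
  refine h.congr fun n => ?_
  rw [integral_map .of_discrete .of_discrete]
  rfl

lemma tendstoInDistribution_diagCount_add (hL : IsParameterRegime L) {k : ℕ} (hk : 1 < k)
    {P : ∀ n : ℕ, ProbabilityMeasure (StaircaseTableau n)}
    (hP : ∀ (n : ℕ) (S : StaircaseTableau n), Tendsto (fun w : ℝ × ℝ => S.prob w.1 w.2) L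
      (𝓝 ((P n : Measure (StaircaseTableau n)).real {S}))) :
    TendstoInDistribution
      (fun (n : ℕ) (S : StaircaseTableau n) => S.diagCount k .alpha + S.diagCount k .beta)
      atTop (id : ℕ → ℕ) (fun n => (P n : Measure (StaircaseTableau n))) (poissonMeasure 1) := by
  -- The coordinates on the product space realise the independent pair, so continuity of addition
  -- and the sum law for Poisson variables apply.
  set μ : Measure (ℕ × ℕ) := (poissonMeasure (1 / 2)).prod (poissonMeasure (1 / 2))
  have h₁ : HasLaw (Prod.fst : ℕ × ℕ → ℕ) (poissonMeasure (1 / 2)) μ :=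
    ⟨.of_discrete, by simp [μ, Measure.map_fst_prod]⟩
  have h₂ : HasLaw (Prod.snd : ℕ × ℕ → ℕ) (poissonMeasure (1 / 2)) μ :=
    ⟨.of_discrete, by simp [μ, Measure.map_snd_prod]⟩
  have h₁₂ : IndepFun (Prod.fst : ℕ × ℕ → ℕ) Prod.snd μ := by
    rw [indepFun_iff_map_prod_eq_prod_map_map h₁.aemeasurable h₂.aemeasurable, h₁.map_eq,
      h₂.map_eq]
    exact Measure.map_id
  have h := (hL.tendstoInDistribution_diagCount hk hP μ _ _ h₁ h₂ h₁₂).continuous_comp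
    (g := fun p : ℕ × ℕ => p.1 + p.2) (by fun_prop)
  have hsum := (h₁₂.hasLaw_add_poissonMeasure h₁ h₂).map_eq
  rw [add_halves] at hsum
  refine ⟨fun n => .of_discrete, .of_discrete, ?_⟩
  refine h.tendsto.mono_right (le_of_eq (congrArg 𝓝 (Subtype.ext ?_)))
  exact hsum.trans Measure.map_id.symm

end IsParameterRegime

/-- For each parameter regime there is, for every `n`, a random tableau of size `n` whose law `P n`
is `wt / Zₙ` (or its limit along the regime); under it the numbers of `α`'s and of `β`'s on the
`k`-th diagonal converge jointly in distribution to independent Poisson variables of rate `1 / 2`,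
and their sum converges in distribution to a Poisson variable of rate `1`. -/
theorem theorem5p1 (k : ℕ) (hk : 1 < k) (L : Filter (ℝ × ℝ)) (hL : IsParameterRegime L) :
    ∃ P : ∀ n : ℕ, ProbabilityMeasure (StaircaseTableau n),
      (∀ (n : ℕ) (S : StaircaseTableau n),
        Tendsto (fun w : ℝ × ℝ => S.prob w.1 w.2) L
          (𝓝 ((P n : Measure (StaircaseTableau n)).real {S}))) ∧
      (∀ {Ω : Type*} [MeasurableSpace Ω] (μ : Measure Ω) [IsProbabilityMeasure μ]
        (Z₁ Z₂ : Ω → ℕ), HasLaw Z₁ (poissonMeasure (1 / 2)) μ →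
        HasLaw Z₂ (poissonMeasure (1 / 2)) μ → IndepFun Z₁ Z₂ μ →
        TendstoInDistribution
          (fun (n : ℕ) (S : StaircaseTableau n) => (S.diagCount k .alpha, S.diagCount k .beta))
          atTop (fun ω => (Z₁ ω, Z₂ ω))
          (fun n => (P n : Measure (StaircaseTableau n))) μ) ∧
      TendstoInDistribution
        (fun (n : ℕ) (S : StaircaseTableau n) => S.diagCount k .alpha + S.diagCount k .beta)
        atTop (id : ℕ → ℕ)
        (fun n => (P n : Measure (StaircaseTableau n))) (poissonMeasure 1) := by
  choose P hP using hL.exists_law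
  exact ⟨P, hP, fun μ _ Z₁ Z₂ h₁ h₂ h₁₂ =>
    hL.tendstoInDistribution_diagCount hk hP μ Z₁ Z₂ h₁ h₂ h₁₂,
    hL.tendstoInDistribution_diagCount_add hk hP⟩
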